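/- **Notation.** Write $e(t)=e^{2\pi i t}$ and $G=\mathbb R\times\mathbb R$ with Lebesgue measure. Inner products are linear in the first variable. For $x=(x',x'')\in G$ and $y=(y',y'')\in G$ put $\beta(x,y)=e(x'y'')$, $R(x',x'')=(-x'',x')$, and let $\pi_x$ be the unitary operator $(\pi_xf)(t)=e(tx'')f(t+x')$ on $L^2(\mathbb R)$. For a lattice $D\subset G$ let $|G/D|$ be its covolume, $D^\perp=\{w\in G:\beta(x,w)=\beta(w,x)\ \forall x\in D\}$, and let $C^*(D,\beta)$ be the $C^*$-algebra of operators on $L^2(\mathbb R)$ generated by the $\pi_w$, $w\in D$. Its canonical trace $\tau_D$ is the continuous linear functional with $\tau_D(\pi_0)=1$ and $\tau_D(\pi_w)=0$ for $w\in D\setminus\{0\}$. For $f,g\in\mathcal S(\mathbb R)$ put $$\langle f,g\rangle_D=|G/D|\sum_{w\in D}\langle f,\pi_wg\rangle_{L^2}\,\pi_w\in C^*(D,\beta),\qquad \langle f,g\rangle_{D^\perp}=\sum_{z\in D^\perp}\langle \pi_zg,f\rangle_{L^2}\,\pi_z^*\in C^*(D^\perp,\beta).$$ An element $b=\sum_z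 b(z)\pi_z^*$ acts on functions from the right by $fb=\sum_z b(z)\pi_z^*f$. Let $\mathcal F$ be the Fourier transform, $(\mathcal Ff)(s)=\int f(x)e(-xs)\,dx$. **Proposition 1.1.** Let $\alpha\in(0,1)$ and let $D=\mathbb Z\varepsilon_1+\mathbb Z\varepsilon_2$ be a lattice in $G=\mathbb R^2$ such that $R\varepsilon_1=\varepsilon_2$, $\beta(\varepsilon_j,\varepsilon_j)=1$ for $j=1,2$, and $\beta(\varepsilon_1,\varepsilon_2)\overline{\beta(\varepsilon_2,\varepsilon_1)}=e^{2\pi i\alpha}$. Put $U_j=\pi_{\varepsilon_j}$ and $A_\alpha=C^*(D,\beta)$. Then $A_\alpha$ is generated by $U_1,U_2$, one has $U_1U_2=e^{2\pi i\alpha}U_2U_1$, and $\sigma(T)=\mathcal FT\mathcal F^{-1}$ defines a $*$-automorphism $\sigma=\sigma_D$ of $A_\alpha$ with $\sigma(U_1)=U_2$, $\sigma(U_2)=U_1^{-1}$. Assume moreover that $f\in\mathcal S(\mathbb R)$ satisfies $\mathcal Ff=\lambda f$ for some $\lambda\in\{\pm1,\pm i\}$ and that $a=\langle f,f\rangle_{D^\perp}$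 is invertible in $C^*(D^\perp,\beta)$. Then $fa^{-1/2}$ is a Schwartz function, and $p=\langle fa^{-1/2},fa^{-1/2}\rangle_D$ is a projection in $A_\alpha$ such that $$\tau_D(p)=|G/D|=\alpha\qquad\text{and}\qquad \sigma(p)=p .$$ -/

import Mathlib

open MeasureTheory FourierTransform SchwartzMap
open scoped ComplexConjugate

noncomputable section

namespace RotationAlgebra

/-! ### Time-frequency shifts on the Hilbert space of square integrable functions on the line -/

/-- The complex Hilbert space of square integrable functions on the real line. -/
abbrev L2R : Type := Lp ℂ 2 (volume : Measure ℝ)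

/-- The character `e(t) = exp(2πit)`; the pairing of `ℝ` with its dual `ℝ` is `⟨x, y⟩ = e(xy)`. -/
def ee (t : ℝ) : ℂ := Complex.exp (2 * Real.pi * Complex.I * t)

theorem norm_ee (t : ℝ) : ‖ee t‖ = 1 := by
  rw [ee, show (2 * Real.pi * Complex.I * t : ℂ) = ((2 * Real.pi * t : ℝ) : ℂ) * Complex.I by
    push_cast; ring, Complex.norm_exp_ofReal_mul_I]

theorem continuous_ee : Continuous ee := by unfold ee; fun_prop

theorem ee_add (s t : ℝ) : ee (s + t) = ee s * ee t := by
  simp only [ee, ← Complex.exp_add]; congr 1; push_cast; ring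

theorem ee_zero : ee 0 = 1 := by simp [ee]

/-- The Heisenberg bicharacter `β((x₁, y₁), (x₂, y₂)) = e(x₁ y₂)` on `G = ℝ × ℝ`. -/
def beta (x y : ℝ × ℝ) : ℂ := ee (x.1 * y.2)

/-- The automorphism `R(w₁, w₂) = (-w₂, w₁)` of `G`. -/
def rot (w : ℝ × ℝ) : ℝ × ℝ := (-w.2, w.1)

/-- The time-frequency shift `t ↦ e(t x'') f(t + x')` of a function, where `x = (x', x'')`. -/
def shiftFun (x : ℝ × ℝ) (f : ℝ → ℂ) (t : ℝ) : ℂ := ee (t * x.2) * f (t + x.1)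

theorem aesm_shift (x : ℝ × ℝ) {f : ℝ → ℂ} (hf : AEStronglyMeasurable f volume) :
    AEStronglyMeasurable (shiftFun x f) volume := by
  have h1 : AEStronglyMeasurable (fun t : ℝ => ee (t * x.2)) volume :=
    (continuous_ee.comp (by fun_prop)).aestronglyMeasurable
  exact h1.mul (hf.comp_measurePreserving (measurePreserving_add_right volume x.1))

theorem eLpNorm_shift (x : ℝ × ℝ) {f : ℝ → ℂ} (hf : AEStronglyMeasurable f volume) :
    eLpNorm (shiftFun x f) 2 volume = eLpNorm f 2 volume := by
  rw [← eLpNorm_comp_measurePreserving hf (measurePreserving_add_right volume x.1)]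
  exact eLpNorm_congr_norm_ae (.of_forall fun t => by simp [shiftFun, norm_ee])

theorem memLp_shift (x : ℝ × ℝ) {f : ℝ → ℂ} (hf : MemLp f 2 volume) :
    MemLp (shiftFun x f) 2 volume :=
  ⟨aesm_shift x hf.1, by rw [eLpNorm_shift x hf.1]; exact hf.2⟩

theorem shift_congr (x : ℝ × ℝ) {f g : ℝ → ℂ} (h : f =ᵐ[volume] g) :
    shiftFun x f =ᵐ[volume] shiftFun x g := by
  have := (measurePreserving_add_right (volume : Measure ℝ) x.1).quasiMeasurePreserving.ae_eq_comp h
  filter_upwards [this] with t ht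
  simp only [Function.comp_apply] at ht
  simp [shiftFun, ht]

/-- The shift as a linear isometry of `L²(ℝ)`. -/
def heisIso (x : ℝ × ℝ) : L2R →ₗᵢ[ℂ] L2R where
  toFun f := (memLp_shift x (Lp.memLp f)).toLp _
  map_add' f g := by
    rw [← MemLp.toLp_add, MemLp.toLp_eq_toLp_iff]
    refine (shift_congr x (Lp.coeFn_add f g)).trans (.of_forall fun t => ?_)
    simp [shiftFun, mul_add]
  map_smul' c f := by
    rw [RingHom.id_apply, ← MemLp.toLp_const_smul, MemLp.toLp_eq_toLp_iff]
    refine (shift_congr x (Lp.coeFn_smul c f)).trans (.of_forall fun t => ?_)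
    simp [shiftFun, mul_left_comm]
  norm_map' f := by
    simp only [LinearMap.coe_mk, AddHom.coe_mk, Lp.norm_toLp]
    rw [eLpNorm_shift x (Lp.aestronglyMeasurable f), Lp.norm_def]

/-- The Heisenberg representation: `(π_x f)(t) = e(t x'') f(t + x')` on `L²(ℝ)`. -/
def heis (x : ℝ × ℝ) : L2R →L[ℂ] L2R := (heisIso x).toContinuousLinearMap

theorem coeFn_heis (x : ℝ × ℝ) (f : L2R) :
    heis x f =ᵐ[volume] fun t => ee (t * x.2) * f (t + x.1) :=
  (memLp_shift x (Lp.memLp f)).coeFn_toLp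

theorem heis_zero : heis 0 = 1 := by
  refine ContinuousLinearMap.ext fun f => Lp.ext ?_
  filter_upwards [coeFn_heis 0 f] with t ht
  simp [ht, ee_zero]

theorem heis_mul (x y : ℝ × ℝ) : heis x * heis y = beta x y • heis (x + y) := by
  refine ContinuousLinearMap.ext fun f => Lp.ext ?_
  have h := (measurePreserving_add_right (volume : Measure ℝ) x.1).quasiMeasurePreserving.ae_eq_comp
    (coeFn_heis y f)
  filter_upwards [coeFn_heis x (heis y f), h, coeFn_heis (x + y) f,
    Lp.coeFn_smul (beta x y) (heis (x + y) f)] with t h1 h2 h3 h4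
  simp only [Function.comp_apply] at h2
  refine Eq.trans h1 (Eq.trans ?_ h4.symm)
  rw [h2, Pi.smul_apply, h3, smul_eq_mul, beta, Prod.fst_add, Prod.snd_add,
    show (t + x.1) * y.2 = t * y.2 + x.1 * y.2 by ring, mul_add t x.2 y.2, ee_add, ee_add,
    ← add_assoc]
  ring

theorem star_heis (x : ℝ × ℝ) : star (heis x) = beta x x • heis (-x) := by
  have h1 : star (heis x) * heis x = 1 := by
    refine ContinuousLinearMap.ext fun f => ext_inner_left ℂ fun g => ?_
    change inner ℂ g (ContinuousLinearMap.adjoint (heis x) (heis x f)) = inner ℂ g f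
    rw [ContinuousLinearMap.adjoint_inner_right]
    exact (heisIso x).inner_map_map g f
  have h2 : heis x * (beta x x • heis (-x)) = 1 := by
    rw [mul_smul_comm, heis_mul, smul_smul, add_neg_cancel, heis_zero, beta, beta, ← ee_add]
    simp [ee_zero]
  exact left_inv_eq_right_inv h1 h2

/-! ### The algebras of a lattice and of its orthogonal lattice -/

/-- `C*(D, β)`: the C*-algebra of operators on `L²(ℝ)` generated by the unitaries `π_w`, `w ∈ D`. -/
def latticeAlg (D : Submodule ℤ (ℝ × ℝ)) : StarSubalgebra ℂ (L2R →L[ℂ] L2R) :=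
  (StarAlgebra.adjoin ℂ {T | ∃ w ∈ D, T = heis w}).topologicalClosure

theorem heis_mem {D : Submodule ℤ (ℝ × ℝ)} {w : ℝ × ℝ} (hw : w ∈ D) : heis w ∈ latticeAlg D :=
  StarSubalgebra.le_topologicalClosure _ (StarAlgebra.subset_adjoin ℂ _ ⟨w, hw, rfl⟩)

/-- The orthogonal lattice `D^⊥ = {w | β(x, w) = β(w, x) for all x ∈ D}`. -/
def perp (D : Submodule ℤ (ℝ × ℝ)) : Submodule ℤ (ℝ × ℝ) :=
  AddSubgroup.toIntSubmodule
    { carrier := {w | ∀ x ∈ D, beta x w = beta w x}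
      zero_mem' := fun x _ => by simp [beta]
      add_mem' := fun {v w} hv hw x hx => by
        have h1 := hv x hx
        have h2 := hw x hx
        simp only [beta] at h1 h2 ⊢
        rw [Prod.snd_add, Prod.fst_add, mul_add, add_mul, ee_add, ee_add, h1, h2]
      neg_mem' := fun {w} hw x hx => by
        have h1 := hw x hx
        simp only [beta] at h1 ⊢
        have h2 : ee (x.1 * w.2) ≠ 0 := by
          intro h; simpa [h] using norm_ee (x.1 * w.2)
        refine mul_left_cancel₀ h2 ?_
        nth_rw 2 [h1]
        rw [← ee_add, ← ee_add]
        simp }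

/-! ### The canonical trace -/

theorem exists_limit_functional {H : Type*} [NormedAddCommGroup H] [InnerProductSpace ℂ H]
    (ψ : ℕ → H) : ∃ τ : (H →L[ℂ] H) →L[ℂ] ℂ, ∀ (T : H →L[ℂ] H) (c : ℂ),
      Filter.Tendsto (fun n => inner ℂ (ψ n) (T (ψ n)) / inner ℂ (ψ n) (ψ n)) Filter.atTop (nhds c) →
        τ T = c := by
  let u : ℕ → (H →L[ℂ] H) → ℂ := fun n T => inner ℂ (ψ n) (T (ψ n)) / inner ℂ (ψ n) (ψ n)
  have hb : ∀ n T, u n T ∈ Metric.closedBall (0 : ℂ) ‖T‖ := by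
    intro n T
    rw [mem_closedBall_zero_iff]
    simp only [u, norm_div]
    refine div_le_of_le_mul₀ (norm_nonneg _) (norm_nonneg _) ?_
    calc ‖inner ℂ (ψ n) (T (ψ n))‖ ≤ ‖ψ n‖ * (‖T‖ * ‖ψ n‖) :=
          (norm_inner_le_norm _ _).trans (by gcongr; exact T.le_opNorm _)
      _ = ‖T‖ * ‖inner ℂ (ψ n) (ψ n)‖ := by
          rw [inner_self_eq_norm_sq_to_K]; simp; ring
  let U : Ultrafilter ℕ := Filter.hyperfilter ℕ
  have hl : ∀ T, ∃ c ∈ Metric.closedBall (0 : ℂ) ‖T‖,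
      Filter.Tendsto (fun n => u n T) U (nhds c) := by
    intro T
    obtain ⟨c, hc, hlim⟩ := (isCompact_closedBall (0 : ℂ) ‖T‖).ultrafilter_le_nhds
      (U.map fun n => u n T) (by
        rw [Filter.le_principal_iff]
        exact Filter.Eventually.of_forall (f := (U : Filter ℕ)) fun n => hb n T)
    exact ⟨c, hc, hlim⟩
  choose v hv hlim using hl
  let L : (H →L[ℂ] H) →ₗ[ℂ] ℂ :=
    { toFun := v
      map_add' := fun S T => tendsto_nhds_unique (hlim (S + T)) (by
        refine ((hlim S).add (hlim T)).congr fun n => ?_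
        simp [u, add_div])
      map_smul' := fun c T => tendsto_nhds_unique (hlim (c • T)) (by
        refine ((hlim T).const_mul c).congr fun n => ?_
        simp [u, mul_div_assoc]) }
  refine ⟨L.mkContinuous 1 fun T => ?_, fun T c h => ?_⟩
  · rw [one_mul]; exact mem_closedBall_zero_iff.1 (hv T)
  · exact tendsto_nhds_unique (hlim T) (h.mono_left Nat.hyperfilter_le_atTop)

/-- An auxiliary chirped Gaussian. -/
def chirp (N : ℝ) (t : ℝ) : ℂ :=
  Complex.exp ((-(Real.pi / N) + Real.pi * N * Complex.I) * t ^ 2)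

theorem chirp_integral {N : ℝ} (hN : 0 < N) (w : ℝ × ℝ) :
    ∫ t : ℝ, ee (t * w.2) * chirp N (t + w.1) * conj (chirp N t) =
      ((Real.pi : ℂ) / -(-(2 * Real.pi / N : ℂ))) ^ (1 / 2 : ℂ) *
        Complex.exp ((-(Real.pi / N) + Real.pi * N * Complex.I) * w.1 ^ 2 -
          (2 * Real.pi * Complex.I * (w.2 + N * w.1) - 2 * Real.pi * w.1 / N) ^ 2 /
            (4 * -(2 * Real.pi / N : ℂ))) := by
  have hb : (-(2 * Real.pi / N : ℂ)).re < 0 := by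
    rw [show (-(2 * Real.pi / N : ℂ)) = ((-(2 * Real.pi / N) : ℝ) : ℂ) by push_cast; ring,
      Complex.ofReal_re]
    have := Real.pi_pos
    simp only [neg_lt_zero]; positivity
  rw [← integral_cexp_quadratic hb]
  congr 1
  funext t
  have : conj (chirp N t) =
      Complex.exp ((-(Real.pi / N) - Real.pi * N * Complex.I) * t ^ 2) := by
    rw [chirp, ← Complex.exp_conj]
    congr 1
    simp [sub_eq_add_neg]
  rw [this, chirp, ee, ← Complex.exp_add, ← Complex.exp_add]
  congr 1
  push_cast
  ring

theorem memLp_chirp {N : ℝ} (hN : 0 < N) : MemLp (chirp N) 2 volume := by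
  have hc : Continuous (chirp N) := by unfold chirp; fun_prop
  rw [memLp_two_iff_integrable_sq_norm hc.aestronglyMeasurable]
  have h := integrable_exp_neg_mul_sq (b := 2 * Real.pi / N) (by have := Real.pi_pos; positivity)
  refine h.congr (.of_forall fun t => ?_)
  have h1 : ((-(Real.pi / N) + Real.pi * N * Complex.I) * t ^ 2 : ℂ) =
      ((-(Real.pi / N) * t ^ 2 : ℝ) : ℂ) + ((Real.pi * N * t ^ 2 : ℝ) : ℂ) * Complex.I := by
    push_cast; ring
  simp only [chirp, h1, Complex.norm_exp, ← Real.exp_nat_mul]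
  congr 1
  simp [-Complex.ofReal_mul, -Complex.ofReal_pow]
  ring

theorem inner_chirp {N : ℝ} (hN : 0 < N) (w : ℝ × ℝ) :
    inner ℂ ((memLp_chirp hN).toLp (chirp N)) (heis w ((memLp_chirp hN).toLp (chirp N))) =
      ∫ t : ℝ, ee (t * w.2) * chirp N (t + w.1) * conj (chirp N t) := by
  rw [L2.inner_def]
  refine integral_congr_ae ?_
  have h := (measurePreserving_add_right (volume : Measure ℝ) w.1).quasiMeasurePreserving.ae_eq_comp
    (memLp_chirp hN).coeFn_toLp
  filter_upwards [coeFn_heis w ((memLp_chirp hN).toLp (chirp N)), (memLp_chirp hN).coeFn_toLp, h]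
    with t h1 h2 h3
  simp only [Function.comp_apply] at h3
  simp [h1, h2, h3]

theorem chirp_quotient {N : ℝ} (hN : 0 < N) (w : ℝ × ℝ) :
    ‖inner ℂ ((memLp_chirp hN).toLp (chirp N)) (heis w ((memLp_chirp hN).toLp (chirp N))) /
      inner ℂ ((memLp_chirp hN).toLp (chirp N)) ((memLp_chirp hN).toLp (chirp N))‖ ≤
      Real.exp (-(Real.pi * N / 2 * (w.2 + N * w.1) ^ 2)) := by
  have h0 := (inner_chirp hN 0).trans (chirp_integral hN 0)
  rw [heis_zero, one_apply_eq_self] at h0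
  have hpi : (Real.pi : ℂ) ≠ 0 := by exact_mod_cast Real.pi_ne_zero
  have hN' : (N : ℂ) ≠ 0 := by exact_mod_cast hN.ne'
  rw [h0, inner_chirp hN, chirp_integral hN w, mul_div_mul_left]
  · simp only [Prod.fst_zero, Prod.snd_zero, Complex.ofReal_zero]
    rw [show (-(Real.pi / N) + Real.pi * N * Complex.I : ℂ) * 0 ^ 2 -
      (2 * Real.pi * Complex.I * (0 + N * 0) - 2 * Real.pi * 0 / N) ^ 2 /
            (4 * -(2 * Real.pi / N : ℂ)) = 0 by simp, Complex.exp_zero, div_one, Complex.norm_exp]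
    have : ((-(Real.pi / N) + Real.pi * N * Complex.I) * w.1 ^ 2 -
          (2 * Real.pi * Complex.I * (w.2 + N * w.1) - 2 * Real.pi * w.1 / N) ^ 2 /
            (4 * -(2 * Real.pi / N : ℂ))) =
        ((-(Real.pi * w.1 ^ 2 / (2 * N)) - Real.pi * N / 2 * (w.2 + N * w.1) ^ 2 : ℝ) : ℂ) +
        ((Real.pi * N * w.1 ^ 2 - Real.pi * w.1 * (w.2 + N * w.1) : ℝ) : ℂ) * Complex.I := by
      push_cast
      field_simp
      ring_nf
      simp only [Complex.I_sq]
      ring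
    rw [this, Complex.add_re, Complex.ofReal_re, Complex.re_ofReal_mul, Complex.I_re, mul_zero,
      add_zero]
    refine Real.exp_le_exp.2 ?_
    have : 0 ≤ Real.pi * w.1 ^ 2 / (2 * N) := by have := Real.pi_pos; positivity
    linarith
  · rw [Complex.cpow_def_of_ne_zero]
    · exact Complex.exp_ne_zero _
    · rw [neg_neg]; exact div_ne_zero hpi (div_ne_zero (mul_ne_zero two_ne_zero hpi) hN')

theorem tendsto_bound {w : ℝ × ℝ} (hw : w ≠ 0) :
    Filter.Tendsto (fun n : ℕ =>
      Real.exp (-(Real.pi * ((n : ℝ) + 1) / 2 * (w.2 + ((n : ℝ) + 1) * w.1) ^ 2)))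
      Filter.atTop (nhds 0) := by
  have hn : Filter.Tendsto (fun n : ℕ => (n : ℝ) + 1) Filter.atTop Filter.atTop :=
    Filter.tendsto_atTop_add_const_right _ _ tendsto_natCast_atTop_atTop
  suffices h : ∃ c > 0, ∀ᶠ n : ℕ in Filter.atTop, c ≤ (w.2 + ((n : ℝ) + 1) * w.1) ^ 2 by
    obtain ⟨c, hc, h⟩ := h
    refine Real.tendsto_exp_neg_atTop_nhds_zero.comp ?_
    refine Filter.tendsto_atTop_mono' _ ?_
      (hn.const_mul_atTop (show 0 < Real.pi / 2 * c by have := Real.pi_pos; positivity))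
    filter_upwards [h] with n h
    have h1 : 0 ≤ Real.pi * ((n : ℝ) + 1) / 2 := by have := Real.pi_pos; positivity
    calc Real.pi / 2 * c * ((n : ℝ) + 1) = Real.pi * ((n : ℝ) + 1) / 2 * c := by ring
      _ ≤ _ := mul_le_mul_of_nonneg_left h h1
  by_cases h1 : w.1 = 0
  · have h2 : w.2 ≠ 0 := fun h2 => hw (Prod.ext h1 h2)
    exact ⟨w.2 ^ 2, by positivity, .of_forall fun n => by simp [h1]⟩
  · refine ⟨1, one_pos, ?_⟩
    have h3 : Filter.Tendsto (fun n : ℕ => ((n : ℝ) + 1) * |w.1| - |w.2|)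
        Filter.atTop Filter.atTop :=
      Filter.tendsto_atTop_add_const_right _ _ (hn.atTop_mul_const (abs_pos.2 h1))
    filter_upwards [h3.eventually_ge_atTop 1] with n hn1
    rw [← sq_abs]
    refine one_le_pow₀ (hn1.trans ?_)
    have h4 : ((n : ℝ) + 1) * |w.1| = |((n : ℝ) + 1) * w.1| := by
      rw [abs_mul, abs_of_nonneg (by positivity : (0 : ℝ) ≤ (n : ℝ) + 1)]
    rw [h4]
    have := abs_sub_abs_le_abs_sub (((n : ℝ) + 1) * w.1) (-w.2)
    rw [abs_neg, sub_neg_eq_add, add_comm (((n : ℝ) + 1) * w.1)] at this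
    exact this

theorem exists_trace (D : Submodule ℤ (ℝ × ℝ)) :
    ∃ τ : latticeAlg D →L[ℂ] ℂ,
      ∀ (w : ℝ × ℝ) (hw : w ∈ D), τ ⟨heis w, heis_mem hw⟩ = if w = 0 then 1 else 0 := by
  have hN : ∀ n : ℕ, 0 < (n : ℝ) + 1 := fun n => by positivity
  obtain ⟨τ, hτ⟩ := exists_limit_functional
    (fun n : ℕ => (memLp_chirp (hN n)).toLp (chirp ((n : ℝ) + 1)))
  refine ⟨⟨⟨⟨fun T => τ T, fun S T => by simp⟩, fun c T => by simp⟩,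
    τ.continuous.comp continuous_subtype_val⟩, fun w hw => ?_⟩
  refine hτ (heis w) _ ?_
  split_ifs with h
  · subst h
    refine tendsto_const_nhds.congr fun n => ?_
    rw [heis_zero, one_apply_eq_self, div_self]
    have h0 := (inner_chirp (hN n) 0).trans (chirp_integral (hN n) 0)
    rw [heis_zero, one_apply_eq_self] at h0
    rw [h0]
    have hpi : (Real.pi : ℂ) ≠ 0 := by exact_mod_cast Real.pi_ne_zero
    have hN' : (((n : ℝ) + 1 : ℝ) : ℂ) ≠ 0 := by exact_mod_cast (hN n).ne'
    refine mul_ne_zero ?_ (Complex.exp_ne_zero _)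
    rw [Complex.cpow_def_of_ne_zero]
    · exact Complex.exp_ne_zero _
    · rw [neg_neg]; exact div_ne_zero hpi (div_ne_zero (mul_ne_zero two_ne_zero hpi) hN')
  · exact squeeze_zero_norm (fun n => chirp_quotient (hN n) w) (tendsto_bound h)

/-- The canonical normalized trace `τ_D` on `C*(D, β)`, `τ_D (∑ a_w π_w) = a_0`: the continuous
linear functional with `τ_D (π_0) = 1` and `τ_D (π_w) = 0` for `w ≠ 0` (unique, as shown below). -/
def canonicalTrace (D : Submodule ℤ (ℝ × ℝ)) : latticeAlg D →L[ℂ] ℂ := (exists_trace D).choose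

theorem canonicalTrace_heis (D : Submodule ℤ (ℝ × ℝ)) (w : ℝ × ℝ) (hw : w ∈ D) :
    canonicalTrace D ⟨heis w, heis_mem hw⟩ = if w = 0 then 1 else 0 :=
  (exists_trace D).choose_spec w hw

theorem canonicalTrace_unique (D : Submodule ℤ (ℝ × ℝ)) (τ : latticeAlg D →L[ℂ] ℂ)
    (h : ∀ (w : ℝ × ℝ) (hw : w ∈ D), τ ⟨heis w, heis_mem hw⟩ = if w = 0 then 1 else 0) :
    τ = canonicalTrace D := by
  have hS : ∀ T ∈ Submonoid.closure
      ({T | ∃ w ∈ D, T = heis w} ∪ star {T | ∃ w ∈ D, T = heis w}),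
      ∃ (c : ℂ) (w : ℝ × ℝ), w ∈ D ∧ T = c • heis w := by
    intro T hT
    induction hT using Submonoid.closure_induction with
    | mem T hT =>
      rcases hT with ⟨w, hw, rfl⟩ | ⟨w, hw, h⟩
      · exact ⟨1, w, hw, (one_smul _ _).symm⟩
      · exact ⟨beta w w, -w, neg_mem hw, by rw [← star_heis, ← h, star_star]⟩
    | one => exact ⟨1, 0, zero_mem _, by rw [heis_zero, one_smul]⟩
    | mul S T _ _ hS hT =>
      obtain ⟨c, w, hw, rfl⟩ := hS
      obtain ⟨d, v, hv, rfl⟩ := hT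
      exact ⟨c * d * beta w v, w + v, add_mem hw hv, by
        rw [smul_mul_smul_comm, heis_mul, smul_smul]⟩
  have hmem : ∀ T ∈ StarAlgebra.adjoin ℂ {T | ∃ w ∈ D, T = heis w}, T ∈ latticeAlg D :=
    fun T hT => StarSubalgebra.le_topologicalClosure _ hT
  have hadj : ∀ T (hT : T ∈ StarAlgebra.adjoin ℂ {T | ∃ w ∈ D, T = heis w}),
      τ ⟨T, hmem T hT⟩ = canonicalTrace D ⟨T, hmem T hT⟩ := by
    have key : ∀ T ∈ Submodule.span ℂ (Submonoid.closure
        ({T | ∃ w ∈ D, T = heis w} ∪ star {T | ∃ w ∈ D, T = heis w}) : Set (L2R →L[ℂ] L2R)),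
        ∃ hT : T ∈ latticeAlg D, τ ⟨T, hT⟩ = canonicalTrace D ⟨T, hT⟩ := by
      intro T hT
      induction hT using Submodule.span_induction with
      | mem T hT =>
        obtain ⟨c, w, hw, rfl⟩ := hS T hT
        refine ⟨(latticeAlg D).smul_mem (heis_mem hw) c, ?_⟩
        have h1 := h w hw
        rw [← canonicalTrace_heis D w hw] at h1
        have h2 := congrArg (c • ·) h1
        simp only [← map_smul] at h2
        exact h2
      | zero => exact ⟨zero_mem _, (map_zero τ).trans (map_zero (canonicalTrace D)).symm⟩
      | add S T _ _ hS hT =>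
        obtain ⟨hS, h1⟩ := hS
        obtain ⟨hT, h2⟩ := hT
        refine ⟨add_mem hS hT, ?_⟩
        have h3 := congrArg₂ (· + ·) h1 h2
        simp only [← map_add] at h3
        exact h3
      | smul c T _ hT =>
        obtain ⟨hT, h1⟩ := hT
        refine ⟨(latticeAlg D).smul_mem hT c, ?_⟩
        have h2 := congrArg (c • ·) h1
        simp only [← map_smul] at h2
        exact h2
    intro T hT
    obtain ⟨_, h1⟩ := key T (by
      rw [← StarAlgebra.adjoin_eq_span]
      exact hT)
    exact h1
  refine ContinuousLinearMap.ext fun ⟨T, hT⟩ => ?_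
  obtain ⟨x, hx, hlim⟩ := mem_closure_iff_seq_limit.1 (show T ∈ closure
    (StarAlgebra.adjoin ℂ {T | ∃ w ∈ D, T = heis w} : Set (L2R →L[ℂ] L2R)) from hT)
  have hlim' : Filter.Tendsto (fun n => (⟨x n, hmem _ (hx n)⟩ : latticeAlg D)) Filter.atTop
      (nhds ⟨T, hT⟩) := tendsto_subtype_rng.2 hlim
  refine tendsto_nhds_unique ((τ.continuous.tendsto _).comp hlim') ?_
  exact (((canonicalTrace D).continuous.tendsto _).comp hlim').congr fun n =>
    (hadj (x n) (hx n)).symm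

/-! ### The algebra-valued inner products -/

/-- The coefficient `⟨f, g⟩_D (w) = ⟨f, π_w g⟩ = ∫ f(s) conj(g(s + w')) conj(e(s w'')) ds`. -/
def leftCoeff (f g : 𝓢(ℝ, ℂ)) (w : ℝ × ℝ) : ℂ :=
  ∫ s : ℝ, f s * conj (g (s + w.1)) * conj (ee (s * w.2))

/-- The coefficient `⟨f, g⟩_{D^⊥} (z) = ⟨π_z g, f⟩ = ∫ conj(f(s)) g(s + z') e(s z'') ds`. -/
def rightCoeff (f g : 𝓢(ℝ, ℂ)) (z : ℝ × ℝ) : ℂ :=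
  ∫ s : ℝ, conj (f s) * g (s + z.1) * ee (s * z.2)

/-- `⟨f, g⟩_D = |G/D| ∑_{w ∈ D} ⟨f, g⟩_D (w) π_w`, a norm convergent series of operators: each point
of `D` has mass `|G/D|`. -/
def leftInner (D : Submodule ℤ (ℝ × ℝ)) (f g : 𝓢(ℝ, ℂ)) : L2R →L[ℂ] L2R :=
  (ZLattice.covolume D : ℂ) • ∑' w : D, leftCoeff f g w • heis w

/-- `⟨f, g⟩_{D^⊥} = ∑_{z ∈ D^⊥} ⟨f, g⟩_{D^⊥} (z) π_z^*`, a norm convergent series of operators: each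
point of `D^⊥` has mass one. The right action of an element `b` of this form on a function `h` is
`h b = ∑ b(z) π_z^* h`, that is, the operator `b` applied to `h`. -/
def rightInner (D : Submodule ℤ (ℝ × ℝ)) (f g : 𝓢(ℝ, ℂ)) : L2R →L[ℂ] L2R :=
  ∑' z : perp D, rightCoeff f g z • star (heis z)

/-- `a^{-1/2}` for a positive invertible operator `a`, by continuous functional calculus. -/
def invSqrt {H : Type*} [NormedAddCommGroup H] [InnerProductSpace ℂ H] [CompleteSpace H]
    (a : H →L[ℂ] H) : H →L[ℂ] H := a ^ (-(1 / 2) : ℝ)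

/-- Conjugation `T ↦ F T F⁻¹` by the Fourier transform `F` of `L²(ℝ)`. Its restriction to `C*(D, β)`
is `σ_D`, the map that satisfies `F (T ξ) = σ_D(T) (F ξ)` for all `ξ`. -/
def fourierAut : (L2R →L[ℂ] L2R) ≃⋆ₐ[ℂ] (L2R →L[ℂ] L2R) :=
  (Lp.fourierTransformₗᵢ ℝ ℂ).conjStarAlgEquiv

end RotationAlgebra

end

open RotationAlgebra

namespace RotationAlgebra

/-! ### The character and the bicharacter -/

/-! Write V(f,g)(z) = ⟨π_z g, f⟩ for the coefficient `rightCoeff f g z`, and κ = |ε₁|² for the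
covolume of D. The orthogonal lattice is D^⊥ = κ⁻¹D.

Everything rests on one Poisson summation. The symplectic Fourier transform of conj V(f,g) · V(k,h)
is V(g,h) · conj V(f,k) (`integral_conj_rightCoeff_mul`), so κ times the sum of the first product
over D equals the sum of the second over D^⊥ (`tsum_conj_rightCoeff_mul`). Tested against Schwartz
functions, this is the associativity ⟨f,g⟩_D h = f⟨g,h⟩_{D^⊥} (`leftInner_apply_toLp`). It also
makes a = ⟨f,f⟩_{D^⊥} positive, since ⟨ah,h⟩ = κ ∑_D |V(h,f)|².

Let b = a^{-1/2}. That g = fb is Schwartz is a smoothness argument. Conjugation by π_{sx} multiplies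
the coefficients of an operator by characters in s. The orbit of a is smooth because its
coefficients decay rapidly; b is a norm convergent power series in 1 - a/r, so its orbit is smooth
too; differentiating it at s = 0 shows that the coefficients of b decay rapidly
(`functional_invSqrt_decay`). The corresponding series of shifts of a Schwartz function is again
Schwartz (`exists_schwartz_invSqrt`).

Since b is self-adjoint and commutes with every π_w, w ∈ D, associativity gives ⟨g,g⟩_{D^⊥} = bab =
1 (`rightInner_normalized_eq_one`). So the vectors π_z^* g, z ∈ D^⊥, are orthonormal, p = ⟨g,g⟩_D
fixes each of them, and every ph is a sum of multiples of them: p is a projection. Its trace is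
κ‖g‖² = κ. The fundamental identity for g alone reads κ ∑_D |V(g,g)|² = 1, and the term at 0 is 1,
so κ ≤ 1; with e(κ) = e(α) this forces κ = α.

Finally, 𝓕 π_z 𝓕⁻¹ is a phase times π_{Rz}, with phases matching those of the coefficients, so
σ⟨f,g⟩ = ⟨𝓕f,𝓕g⟩ for both inner products. Thus 𝓕f = λf with |λ| = 1 gives σ(a) = a, σ(b) = b, 𝓕g =
λg and σ(p) = p. -/

theorem ee_ne_zero (t : ℝ) : ee t ≠ 0 := by
  intro h; simpa [h] using norm_ee t

theorem ee_neg (t : ℝ) : ee (-t) = conj (ee t) := by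
  rw [ee, ee, ← Complex.exp_conj]; congr 1; simp [Complex.conj_ofNat]

theorem conj_ee_mul_ee (t : ℝ) : conj (ee t) * ee t = 1 := by
  rw [← ee_neg, ← ee_add, neg_add_cancel, ee_zero]

theorem norm_beta (x y : ℝ × ℝ) : ‖beta x y‖ = 1 := norm_ee _

theorem beta_ne_zero (x y : ℝ × ℝ) : beta x y ≠ 0 := ee_ne_zero _

theorem ee_eq_one_iff (t : ℝ) : ee t = 1 ↔ ∃ n : ℤ, t = n := by
  rw [ee, Complex.exp_eq_one_iff]
  have h : (2 * Real.pi * Complex.I : ℂ) ≠ 0 := Complex.two_pi_I_ne_zero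
  refine exists_congr fun n => ?_
  rw [mul_comm (n : ℂ), mul_right_inj' h]
  exact_mod_cast Iff.rfl

theorem ee_eq_ee_iff (s t : ℝ) : ee s = ee t ↔ ∃ n : ℤ, s - t = n := by
  rw [← ee_eq_one_iff, sub_eq_add_neg, ee_add]
  constructor
  · rintro h; rw [h, ← ee_add, add_neg_cancel, ee_zero]
  · intro h
    have := congrArg (· * ee t) h
    simpa [mul_assoc, ← ee_add, ee_zero] using this

theorem contDiff_ee_mul (c : ℝ) {n : WithTop ℕ∞} : ContDiff ℝ n fun t : ℝ => ee (t * c) := by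
  have h : ContDiff ℝ n fun t : ℝ => ((t * c : ℝ) : ℂ) :=
    Complex.ofRealCLM.contDiff.comp (contDiff_id.mul contDiff_const)
  exact (contDiff_const.mul h).cexp

theorem hasDerivAt_ee_mul (c t : ℝ) :
    HasDerivAt (fun t : ℝ => ee (t * c)) (2 * Real.pi * Complex.I * c * ee (t * c)) t := by
  have h : HasDerivAt (fun t : ℝ => (2 * Real.pi * Complex.I * (t * c : ℝ) : ℂ))
      (2 * Real.pi * Complex.I * c) t := by
    have := ((hasDerivAt_id t).mul_const c).ofReal_comp.const_mul (2 * Real.pi * Complex.I : ℂ)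
    simpa using this
  simpa [ee, mul_comm] using h.cexp

theorem iteratedDeriv_ee_mul (c : ℝ) (n : ℕ) :
    iteratedDeriv n (fun t : ℝ => ee (t * c)) =
      fun t => (2 * Real.pi * Complex.I * c) ^ n * ee (t * c) := by
  induction n with
  | zero => simp
  | succ n ih =>
    rw [iteratedDeriv_succ, ih]
    funext t
    rw [((hasDerivAt_ee_mul c t).const_mul _).deriv]
    ring

theorem norm_iteratedFDeriv_ee_mul (c : ℝ) (n : ℕ) (t : ℝ) :
    ‖iteratedFDeriv ℝ n (fun t : ℝ => ee (t * c)) t‖ = (2 * Real.pi * |c|) ^ n := by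
  rw [norm_iteratedFDeriv_eq_norm_iteratedDeriv, iteratedDeriv_ee_mul]
  simp [norm_ee, abs_of_pos Real.pi_pos]

/-! ### Shifts of Schwartz functions -/

theorem contDiff_shiftFun (z : ℝ × ℝ) {f : ℝ → ℂ} {n : WithTop ℕ∞} (hf : ContDiff ℝ n f) :
    ContDiff ℝ n (shiftFun z f) :=
  (contDiff_ee_mul z.2).mul (hf.comp (contDiff_id.add contDiff_const))

theorem norm_iteratedFDeriv_shiftFun_le (z : ℝ × ℝ) (f : 𝓢(ℝ, ℂ)) (n : ℕ) (t : ℝ) :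
    ‖iteratedFDeriv ℝ n (shiftFun z f) t‖ ≤ ∑ i ∈ Finset.range (n + 1),
      n.choose i * (2 * Real.pi * |z.2|) ^ i * ‖iteratedFDeriv ℝ (n - i) f (t + z.1)‖ := by
  refine (norm_iteratedFDeriv_mul_le (contDiff_ee_mul z.2)
    ((f.smooth ⊤).comp (contDiff_id.add contDiff_const)) t
    (n := n) (N := ((⊤ : ℕ∞) : WithTop ℕ∞)) (by exact_mod_cast le_top)).trans (le_of_eq ?_)
  refine Finset.sum_congr rfl fun i _ => ?_
  rw [norm_iteratedFDeriv_ee_mul]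
  congr 2
  exact iteratedFDeriv_comp_add_right _ _ _

/-- Schwartz seminorms of a shift grow only polynomially in z: the translation costs k powers and
the derivatives of the character cost n more. Rapidly decaying coefficients will beat this growth.
-/
theorem shiftFun_decay (f : 𝓢(ℝ, ℂ)) (k n : ℕ) : ∃ C, 0 ≤ C ∧ ∀ (z : ℝ × ℝ) (t : ℝ),
    ‖t‖ ^ k * ‖iteratedFDeriv ℝ n (shiftFun z f) t‖ ≤ C * (1 + ‖z‖) ^ (k + n) := by
  have hS : ∀ m, ∃ S, 0 ≤ S ∧ ∀ x, (1 + ‖x‖) ^ k * ‖iteratedFDeriv ℝ m f x‖ ≤ S := fun m =>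
    ⟨_, by positivity, fun x => one_add_le_sup_seminorm_apply (𝕜 := ℝ) (m := (k, m)) le_rfl le_rfl f x⟩
  choose S hS0 hS using hS
  refine ⟨∑ i ∈ Finset.range (n + 1), n.choose i * (2 * Real.pi) ^ i * S (n - i),
    Finset.sum_nonneg fun i _ => mul_nonneg (by have := Real.pi_pos; positivity) (hS0 _),
    fun z t => ?_⟩
  refine (mul_le_mul_of_nonneg_left (norm_iteratedFDeriv_shiftFun_le z f n t)
    (by positivity)).trans ?_
  rw [Finset.mul_sum, Finset.sum_mul]
  refine Finset.sum_le_sum fun i hi => ?_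
  have hi : i ≤ n := Nat.lt_succ_iff.1 (Finset.mem_range.1 hi)
  have h1 : ‖t‖ ^ k ≤ (1 + ‖z‖) ^ k * (1 + ‖t + z.1‖) ^ k := by
    rw [← mul_pow]
    gcongr
    have h2 : ‖t‖ ≤ ‖t + z.1‖ + ‖z.1‖ := by simpa using norm_sub_le (t + z.1) z.1
    have h3 := norm_fst_le z
    nlinarith [norm_nonneg z, norm_nonneg (t + z.1)]
  have h2 : |z.2| ^ i ≤ (1 + ‖z‖) ^ n := by
    have h3 : |z.2| ≤ ‖z‖ := norm_snd_le z
    calc |z.2| ^ i ≤ (1 + ‖z‖) ^ i := by gcongr; linarith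
      _ ≤ (1 + ‖z‖) ^ n := pow_le_pow_right₀ (by linarith [norm_nonneg z]) hi
  have hpi := Real.pi_pos
  calc ‖t‖ ^ k * (n.choose i * (2 * Real.pi * |z.2|) ^ i * ‖iteratedFDeriv ℝ (n - i) f (t + z.1)‖)
      ≤ ((1 + ‖z‖) ^ k * (1 + ‖t + z.1‖) ^ k) * (n.choose i * ((2 * Real.pi) ^ i * (1 + ‖z‖) ^ n) *
          ‖iteratedFDeriv ℝ (n - i) f (t + z.1)‖) := by
        rw [mul_pow]; gcongr
    _ = n.choose i * (2 * Real.pi) ^ i * ((1 + ‖z‖) ^ (k + n)) *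
          ((1 + ‖t + z.1‖) ^ k * ‖iteratedFDeriv ℝ (n - i) f (t + z.1)‖) := by ring
    _ ≤ n.choose i * (2 * Real.pi) ^ i * ((1 + ‖z‖) ^ (k + n)) * S (n - i) := by
        gcongr; exact hS _ _
    _ = _ := by ring

/-- The time-frequency shift of a Schwartz function. -/
noncomputable def schwartzShift (z : ℝ × ℝ) (f : 𝓢(ℝ, ℂ)) : 𝓢(ℝ, ℂ) where
  toFun := shiftFun z f
  smooth' := contDiff_shiftFun z (f.smooth ⊤)
  decay' k n := by
    obtain ⟨C, _, hC⟩ := shiftFun_decay f k n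
    exact ⟨_, hC z⟩

theorem schwartzShift_apply (z : ℝ × ℝ) (f : 𝓢(ℝ, ℂ)) (t : ℝ) :
    schwartzShift z f t = ee (t * z.2) * f (t + z.1) := rfl

theorem heis_toLp (z : ℝ × ℝ) (f : 𝓢(ℝ, ℂ)) :
    heis z (f.toLp 2 volume) = (schwartzShift z f).toLp 2 volume := by
  refine Lp.ext ?_
  have h := (measurePreserving_add_right (volume : Measure ℝ) z.1).quasiMeasurePreserving.ae_eq_comp
    (f.coeFn_toLp 2 volume)
  filter_upwards [coeFn_heis z (f.toLp 2 volume), h, (schwartzShift z f).coeFn_toLp 2 volume]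
    with t h1 h2 h3
  simp only [Function.comp_apply] at h2
  rw [h1, h2, h3, schwartzShift_apply]

/-- The adjoint time-frequency shift of a Schwartz function. -/
noncomputable def schwartzStarShift (z : ℝ × ℝ) (f : 𝓢(ℝ, ℂ)) : 𝓢(ℝ, ℂ) :=
  beta z z • schwartzShift (-z) f

theorem toLp_smul (c : ℂ) (f : 𝓢(ℝ, ℂ)) :
    (c • f).toLp 2 volume = c • f.toLp 2 volume :=
  map_smul (toLpCLM ℂ ℂ 2 (volume : Measure ℝ)) c f

theorem star_heis_toLp (z : ℝ × ℝ) (f : 𝓢(ℝ, ℂ)) :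
    star (heis z) (f.toLp 2 volume) = (schwartzStarShift z f).toLp 2 volume := by
  rw [star_heis, schwartzStarShift, toLp_smul, ← heis_toLp]; rfl

theorem dense_schwartz : DenseRange fun f : 𝓢(ℝ, ℂ) => f.toLp 2 (volume : Measure ℝ) :=
  denseRange_toLpCLM (E := ℝ) (F := ℂ) ENNReal.ofNat_ne_top

theorem eq_of_inner_schwartz {x y : L2R}
    (h : ∀ k : 𝓢(ℝ, ℂ), inner ℂ (k.toLp 2 volume) x = inner ℂ (k.toLp 2 volume) y) : x = y := by
  refine ext_inner_left ℂ fun v => ?_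
  refine dense_schwartz.induction_on (p := fun v => inner ℂ v x = inner ℂ v y) v ?_ h
  exact isClosed_eq (by fun_prop) (by fun_prop)

theorem clm_eq_of_schwartz {S T : L2R →L[ℂ] L2R}
    (h : ∀ f : 𝓢(ℝ, ℂ), S (f.toLp 2 volume) = T (f.toLp 2 volume)) : S = T := by
  refine ContinuousLinearMap.ext fun v => ?_
  exact dense_schwartz.induction_on (p := fun v => S v = T v) v
    (isClosed_eq (by fun_prop) (by fun_prop)) h

theorem clm_eq_of_inner_schwartz {S T : L2R →L[ℂ] L2R}
    (h : ∀ k f : 𝓢(ℝ, ℂ), inner ℂ (k.toLp 2 volume) (S (f.toLp 2 volume)) =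
      inner ℂ (k.toLp 2 volume) (T (f.toLp 2 volume))) : S = T :=
  clm_eq_of_schwartz fun f => eq_of_inner_schwartz fun k => h k f

theorem inner_star_left (T : L2R →L[ℂ] L2R) (u v : L2R) :
    inner ℂ (star T u) v = inner ℂ u (T v) := ContinuousLinearMap.adjoint_inner_left T v u

theorem inner_star_right (T : L2R →L[ℂ] L2R) (u v : L2R) :
    inner ℂ u (star T v) = inner ℂ (T u) v := ContinuousLinearMap.adjoint_inner_right T u v

/-! ### The coefficients -/

theorem rightCoeff_eq_inner (f g : 𝓢(ℝ, ℂ)) (z : ℝ × ℝ) :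
    rightCoeff f g z = inner ℂ (f.toLp 2 volume) (heis z (g.toLp 2 volume)) := by
  rw [heis_toLp, inner_toL2_toL2_eq f (schwartzShift z g) volume, rightCoeff]
  congr 1; funext s
  rw [schwartzShift_apply, RCLike.inner_apply]; ring

/-- Reduces both inner products to the single function `rightCoeff`, for which all estimates are
made. -/
theorem leftCoeff_eq_conj (f g : 𝓢(ℝ, ℂ)) (w : ℝ × ℝ) :
    leftCoeff f g w = conj (rightCoeff f g w) := by
  rw [leftCoeff, rightCoeff, ← integral_conj]
  simp

theorem heis_star_mul_self (z : ℝ × ℝ) : star (heis z) * heis z = 1 := by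
  rw [star_heis, smul_mul_assoc, heis_mul, smul_smul, neg_add_cancel, heis_zero, beta, beta,
    ← ee_add]
  simp [ee_zero]

theorem heis_mul_star_self (z : ℝ × ℝ) : heis z * star (heis z) = 1 := by
  rw [star_heis, mul_smul_comm, heis_mul, smul_smul, add_neg_cancel, heis_zero, beta, beta,
    ← ee_add]
  simp [ee_zero]

theorem norm_heis_le (z : ℝ × ℝ) : ‖heis z‖ ≤ 1 :=
  (heisIso z).norm_toContinuousLinearMap_le

theorem norm_star_heis_le (z : ℝ × ℝ) : ‖star (heis z)‖ ≤ 1 :=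
  (norm_star (heis z)).trans_le (norm_heis_le z)

/-! ### The Fourier transform -/

/-- The Fourier transform exchanges translation and modulation; the phase comes from restoring their
order. -/
theorem fourier_schwartzShift (z : ℝ × ℝ) (f : 𝓢(ℝ, ℂ)) :
    𝓕 (schwartzShift z f) = conj (beta z z) • schwartzShift (rot z) (𝓕 f) := by
  ext s
  rw [SchwartzMap.fourier_coe, Real.fourier_real_eq_integral_exp_smul]
  change _ = conj (beta z z) * schwartzShift (rot z) (𝓕 f) s
  rw [schwartzShift_apply, SchwartzMap.fourier_coe, Real.fourier_real_eq_integral_exp_smul,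
    ← mul_assoc, ← integral_const_mul]
  conv_rhs => rw [← integral_add_right_eq_self _ z.1]
  congr 1; funext t
  rw [schwartzShift_apply, rot, beta, ← ee_neg, smul_eq_mul, smul_eq_mul]
  simp only [ee, ← mul_assoc, ← Complex.exp_add]
  congr 2
  push_cast
  ring

theorem fourier_heis (z : ℝ × ℝ) (v : L2R) :
    𝓕 (heis z v) = conj (beta z z) • heis (rot z) (𝓕 v) := by
  refine dense_schwartz.induction_on
    (p := fun v => 𝓕 (heis z v) = conj (beta z z) • heis (rot z) (𝓕 v)) v ?_ fun f => ?_
  · have h : Continuous fun v : L2R => 𝓕 v := (Lp.fourierTransformₗᵢ ℝ ℂ).continuous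
    exact isClosed_eq (h.comp (heis z).continuous)
      (((heis (rot z)).continuous.comp h).const_smul (conj (beta z z)))
  · rw [heis_toLp, SchwartzMap.toLp_fourier_eq, SchwartzMap.toLp_fourier_eq, heis_toLp,
      fourier_schwartzShift, toLp_smul]

theorem fourierAut_heis (z : ℝ × ℝ) : fourierAut (heis z) = conj (beta z z) • heis (rot z) := by
  refine ContinuousLinearMap.ext fun v => ?_
  change 𝓕 (heis z ((Lp.fourierTransformₗᵢ ℝ ℂ).symm v)) = _
  rw [fourier_heis]
  change _ • heis (rot z) (Lp.fourierTransformₗᵢ ℝ ℂ ((Lp.fourierTransformₗᵢ ℝ ℂ).symm v)) = _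
  rw [LinearIsometryEquiv.apply_symm_apply]; rfl

theorem fourier_clm_apply (T : L2R →L[ℂ] L2R) (v : L2R) : 𝓕 (T v) = fourierAut T (𝓕 v) := by
  change _ = 𝓕 (T ((Lp.fourierTransformₗᵢ ℝ ℂ).symm (Lp.fourierTransformₗᵢ ℝ ℂ v)))
  rw [LinearIsometryEquiv.symm_apply_apply]

theorem rightCoeff_fourier (f g : 𝓢(ℝ, ℂ)) (z : ℝ × ℝ) :
    rightCoeff (𝓕 f) (𝓕 g) (rot z) = beta z z * rightCoeff f g z := by
  rw [rightCoeff_eq_inner, rightCoeff_eq_inner, ← Lp.inner_fourier_eq (f.toLp 2 volume),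
    fourier_heis, inner_smul_right, ← mul_assoc, SchwartzMap.toLp_fourier_eq,
    SchwartzMap.toLp_fourier_eq, mul_comm (beta z z), beta, conj_ee_mul_ee, one_mul]

/-! ### Poisson summation in two variables -/

/-- The weight `1 / (1 + x²)`. -/
noncomputable def weight (x : ℝ) : ℝ := (1 + x ^ 2)⁻¹

theorem weight_pos (x : ℝ) : 0 < weight x := by unfold weight; positivity

theorem weight_le_one (x : ℝ) : weight x ≤ 1 := inv_le_one_of_one_le₀ (by nlinarith [sq_nonneg x])

theorem weight_sq_le (x : ℝ) : weight x ^ 2 ≤ weight x := by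
  nlinarith [weight_pos x, weight_le_one x]

theorem integrable_weight : Integrable weight := integrable_inv_one_add_sq

theorem integral_weight : ∫ x, weight x = Real.pi := integral_univ_inv_one_add_sq

theorem weight_le_rpow {x : ℝ} (hx : x ≠ 0) : weight x ≤ |x| ^ (-2 : ℝ) := by
  have h : |x| ^ (-2 : ℝ) = (x ^ 2)⁻¹ := by
    rw [Real.rpow_neg (abs_nonneg x), show (2 : ℝ) = ((2 : ℕ) : ℝ) by norm_num,
      Real.rpow_natCast, sq_abs]
  rw [h, weight]
  have : 0 < x ^ 2 := by positivity
  gcongr; linarith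

theorem summable_weight : Summable fun n : ℤ => weight n := by
  refine summable_of_isBigO (Real.summable_abs_int_rpow (b := 2) (by norm_num)) ?_
  refine Asymptotics.IsBigO.of_bound 1 ?_
  have : ∀ᶠ n : ℤ in Filter.cofinite, n ≠ 0 := by
    simpa using (Set.finite_singleton (0 : ℤ)).compl_mem_cofinite
  filter_upwards [this] with n hn
  rw [Real.norm_of_nonneg (weight_pos _).le, Real.norm_of_nonneg (by positivity), one_mul]
  exact weight_le_rpow (by exact_mod_cast hn)

theorem summable_weight_mul : Summable fun p : ℤ × ℤ => weight p.1 * weight p.2 :=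
  summable_weight.mul_of_nonneg summable_weight (fun n => (weight_pos n).le)
    fun n => (weight_pos n).le

theorem isBigO_of_le_weight {f : ℝ → ℂ} {C : ℝ} (hC : 0 ≤ C) (h : ∀ x, ‖f x‖ ≤ C * weight x) :
    f =O[Filter.cocompact ℝ] fun x => |x| ^ (-2 : ℝ) := by
  refine Asymptotics.IsBigO.of_bound C ?_
  have : ∀ᶠ x : ℝ in Filter.cocompact ℝ, x ≠ 0 := by
    simpa using (isCompact_singleton (x := (0 : ℝ))).compl_mem_cocompact
  filter_upwards [this] with x hx
  rw [Real.norm_of_nonneg (by positivity)]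
  exact (h x).trans (mul_le_mul_of_nonneg_left (weight_le_rpow hx) hC)

theorem poisson_of_le_weight {f : ℝ → ℂ} (hc : Continuous f) {C : ℝ} (hC : 0 ≤ C)
    (h : ∀ x, ‖f x‖ ≤ C * weight x) (hs : Summable fun n : ℤ => 𝓕 f n) :
    ∑' n : ℤ, f n = ∑' n : ℤ, 𝓕 f n := by
  simpa using Real.tsum_eq_tsum_fourier_of_rpow_decay_of_summable hc (b := 2) (by norm_num)
    (isBigO_of_le_weight hC h) hs 0

theorem norm_fourier_le_of_le_weight {f : ℝ → ℂ} {C : ℝ} (h : ∀ x, ‖f x‖ ≤ C * weight x) (ξ : ℝ) :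
    ‖𝓕 f ξ‖ ≤ C * Real.pi := by
  rw [← integral_weight, ← integral_const_mul, Real.fourier_real_eq_integral_exp_smul f ξ]
  refine norm_integral_le_of_norm_le (G := ℂ) (integrable_weight.const_mul C)
    (.of_forall fun x => ?_)
  rw [norm_smul, Complex.norm_exp_ofReal_mul_I, one_mul]; exact h x

theorem integrable_of_le_weight {f : ℝ → ℂ} (hc : AEStronglyMeasurable f) {C : ℝ}
    (h : ∀ x, ‖f x‖ ≤ C * weight x) : Integrable f :=
  (integrable_weight.const_mul C).mono' hc (.of_forall h)

/-- **Poisson summation** on `ℤ × ℤ`, for functions which decay together with their Fourier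
transform. -/
theorem tsum_prod_eq_tsum_prod_fourier {Ψ Ψ' : ℝ × ℝ → ℂ} (hc : Continuous Ψ)
    (hc' : Continuous Ψ') {C : ℝ}
    (hΨ : ∀ x y, ‖Ψ (x, y)‖ ≤ C * (weight x ^ 2 * weight y ^ 2))
    (hΨ' : ∀ x y, ‖Ψ' (x, y)‖ ≤ C * (weight x ^ 2 * weight y ^ 2))
    (hF : ∀ ξ η, 𝓕 (fun y => 𝓕 (fun x => Ψ (x, y)) ξ) η = Ψ' (ξ, η)) :
    ∑' p : ℤ × ℤ, Ψ (p.1, p.2) = ∑' p : ℤ × ℤ, Ψ' (p.1, p.2) := by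
  -- Both weights equal one at the origin.
  have hC : 0 ≤ C := by
    have h := (norm_nonneg _).trans (hΨ 0 0)
    simpa [weight] using h
  have hw : ∀ x y, weight x ^ 2 * weight y ^ 2 ≤ weight x * weight y := fun x y =>
    mul_le_mul (weight_sq_le x) (weight_sq_le y) (sq_nonneg _) (weight_pos x).le
  have hw1 : ∀ x y, C * (weight x ^ 2 * weight y ^ 2) ≤ C * weight y ^ 2 * weight x :=
    fun x y => by nlinarith [mul_nonneg hC (sq_nonneg (weight y)), weight_sq_le x]
  have hw2 : ∀ x y, C * (weight x ^ 2 * weight y ^ 2) ≤ C * weight x ^ 2 * weight y :=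
    fun x y => by nlinarith [mul_nonneg hC (sq_nonneg (weight x)), weight_sq_le y]
  set Φ : ℝ → ℝ → ℂ := fun ξ y => 𝓕 (fun x => Ψ (x, y)) ξ with hΦ
  have hb1 : ∀ ξ y, ‖Φ ξ y‖ ≤ C * weight y ^ 2 * Real.pi := fun ξ y =>
    norm_fourier_le_of_le_weight (fun x => (hΨ x y).trans (hw1 x y)) ξ
  have hΦc : ∀ ξ, Continuous (Φ ξ) := fun ξ => by
    simp only [hΦ, Real.fourier_real_eq_integral_exp_smul]
    refine continuous_of_dominated (bound := fun x => C * weight x) (fun y => ?_) (fun y => ?_)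
      (integrable_weight.const_mul C) (.of_forall fun x => by fun_prop)
    · exact Continuous.aestronglyMeasurable (by fun_prop)
    · refine .of_forall fun x => ?_
      rw [norm_smul, Complex.norm_exp_ofReal_mul_I, one_mul]
      refine (hΨ x y).trans (mul_le_mul_of_nonneg_left ((hw x y).trans ?_) hC)
      exact mul_le_of_le_one_right (weight_pos x).le (weight_le_one y)
  have hpi := Real.pi_pos
  have hb1' : ∀ ξ y, ‖Φ ξ y‖ ≤ C * Real.pi * weight y := fun ξ y => (hb1 ξ y).trans (by
    nlinarith [mul_nonneg hC hpi.le, weight_sq_le y])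
  have hFΦ : ∀ ξ, 𝓕 (Φ ξ) = fun η => Ψ' (ξ, η) := fun ξ => funext fun η => hF ξ η
  -- Decay in ξ comes from the other side: by Fourier inversion Φ(ξ, ·) is the inverse transform of
  -- Ψ'(ξ, ·), which is small for large ξ.
  have hb2 : ∀ ξ y, ‖Φ ξ y‖ ≤ C * weight ξ ^ 2 * Real.pi := fun ξ y => by
    have h1 : Integrable (Φ ξ) :=
      integrable_of_le_weight (hΦc ξ).aestronglyMeasurable (hb1' ξ)
    have h2 : Integrable (𝓕 (Φ ξ)) := by
      rw [hFΦ]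
      exact integrable_of_le_weight (Continuous.aestronglyMeasurable (by fun_prop))
        fun η => (hΨ' ξ η).trans (hw2 ξ η)
    rw [← congrFun ((hΦc ξ).fourierInv_fourier_eq h1 h2) y, Real.fourierInv_eq_fourier_neg, hFΦ]
    exact norm_fourier_le_of_le_weight (fun η => (hΨ' ξ η).trans (hw2 ξ η)) _
  -- Geometric mean of a bound decaying only in y and one decaying only in ξ. Taking the square root
  -- is why the hypotheses carry squared weights.
  have hb : ∀ ξ y, ‖Φ ξ y‖ ≤ C * Real.pi * (weight ξ * weight y) := fun ξ y => by
    refine le_of_sq_le_sq ?_ ?_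
    · have := mul_le_mul (hb1 ξ y) (hb2 ξ y) (norm_nonneg _) (by positivity)
      rw [← sq] at this
      refine this.trans (le_of_eq ?_); ring
    · have := weight_pos ξ
      have := weight_pos y
      positivity
  have hsum : Summable fun p : ℤ × ℤ => Φ p.1 p.2 :=
    .of_norm_bounded (summable_weight_mul.mul_left (C * Real.pi)) fun p => hb _ _
  have hsΨ : Summable fun p : ℤ × ℤ => Ψ (p.1, p.2) :=
    .of_norm_bounded (summable_weight_mul.mul_left C) fun p =>
      (hΨ _ _).trans (mul_le_mul_of_nonneg_left (hw _ _) hC)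
  have hsΨ' : Summable fun p : ℤ × ℤ => Ψ' (p.1, p.2) :=
    .of_norm_bounded (summable_weight_mul.mul_left C) fun p =>
      (hΨ' _ _).trans (mul_le_mul_of_nonneg_left (hw _ _) hC)
  calc ∑' p : ℤ × ℤ, Ψ (p.1, p.2) = ∑' n : ℤ, ∑' m : ℤ, Ψ (m, n) := by
        rw [hsΨ.tsum_prod]
        exact Summable.tsum_comm (f := fun n m : ℤ => Ψ (m, n))
          ((Equiv.prodComm ℤ ℤ).summable_iff.2 hsΨ)
    _ = ∑' n : ℤ, ∑' j : ℤ, Φ j n := by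
        refine tsum_congr fun n => ?_
        refine poisson_of_le_weight (f := fun x => Ψ (x, n)) (by fun_prop)
          (C := C * weight n ^ 2) (by positivity) (fun x => (hΨ x n).trans (hw1 x n)) ?_
        exact hsum.prod_symm.prod_factor n
    _ = ∑' j : ℤ, ∑' n : ℤ, Φ j n := Summable.tsum_comm (f := fun j n : ℤ => Φ j n) hsum
    _ = ∑' j : ℤ, ∑' k : ℤ, Ψ' (j, k) := by
        refine tsum_congr fun j => ?_
        have h := hFΦ j
        have h1 := poisson_of_le_weight (hΦc j) (by positivity) (hb1' j) (by
          rw [h]; exact hsΨ'.prod_factor j)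
        rw [h1, h]
    _ = _ := (hsΨ'.tsum_prod).symm

/-! ### Decay of the coefficients -/

theorem exists_one_add_pow_mul_le (f : 𝓢(ℝ, ℂ)) (k : ℕ) :
    ∃ S, 0 ≤ S ∧ ∀ x, (1 + ‖x‖) ^ k * ‖f x‖ ≤ S :=
  ⟨2 ^ k * ((Finset.Iic (k, 0)).sup fun m => SchwartzMap.seminorm ℝ m.1 m.2) f, by positivity,
    fun x => by
      simpa using one_add_le_sup_seminorm_apply (𝕜 := ℝ) (m := (k, 0)) le_rfl le_rfl f x⟩

theorem exists_le_weight (f : 𝓢(ℝ, ℂ)) (k : ℕ) :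
    ∃ S, 0 ≤ S ∧ ∀ x, (1 + ‖x‖) ^ k * ‖f x‖ ≤ S * weight x := by
  obtain ⟨S, hS0, hS⟩ := exists_one_add_pow_mul_le f (k + 2)
  refine ⟨S, hS0, fun x => ?_⟩
  rw [weight, ← div_eq_mul_inv, le_div_iff₀ (by positivity)]
  refine le_trans ?_ (hS x)
  have : 1 + x ^ 2 ≤ (1 + ‖x‖) ^ 2 := by
    rw [Real.norm_eq_abs, ← sq_abs x]; nlinarith [abs_nonneg x]
  calc (1 + ‖x‖) ^ k * ‖f x‖ * (1 + x ^ 2) ≤ (1 + ‖x‖) ^ k * ‖f x‖ * (1 + ‖x‖) ^ 2 := by gcongr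
    _ = _ := by ring

theorem rightCoeff_decay_fst (f g : 𝓢(ℝ, ℂ)) (k : ℕ) :
    ∃ C, 0 ≤ C ∧ ∀ z, (1 + |z.1|) ^ k * ‖rightCoeff f g z‖ ≤ C := by
  obtain ⟨S, hS0, hS⟩ := exists_le_weight f k
  obtain ⟨S', hS0', hS'⟩ := exists_one_add_pow_mul_le g k
  have hpi := Real.pi_pos
  refine ⟨S * S' * Real.pi, by positivity, fun z => ?_⟩
  have h1 : (1 + |z.1|) ^ k * ‖rightCoeff f g z‖ =
      ‖∫ s : ℝ, ((1 + |z.1|) ^ k : ℝ) • (conj (f s) * g (s + z.1) * ee (s * z.2))‖ := by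
    rw [integral_smul, norm_smul, Real.norm_of_nonneg (by positivity), rightCoeff]
  rw [h1, ← integral_weight, ← integral_const_mul]
  refine norm_integral_le_of_norm_le (integrable_weight.const_mul _) (.of_forall fun s => ?_)
  rw [norm_smul, norm_mul, norm_mul, norm_ee, RCLike.norm_conj, mul_one,
    Real.norm_of_nonneg (by positivity)]
  -- Peetre's inequality: the polynomial factor is shared between the two Schwartz functions.
  have h2 : (1 + |z.1|) ^ k ≤ (1 + ‖s‖) ^ k * (1 + ‖s + z.1‖) ^ k := by
    rw [← mul_pow]
    gcongr
    have h2 : |z.1| ≤ ‖s + z.1‖ + ‖s‖ := by simpa using norm_sub_le (s + z.1) s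
    nlinarith [norm_nonneg s, norm_nonneg (s + z.1)]
  calc (1 + |z.1|) ^ k * (‖f s‖ * ‖g (s + z.1)‖)
      ≤ ((1 + ‖s‖) ^ k * (1 + ‖s + z.1‖) ^ k) * (‖f s‖ * ‖g (s + z.1)‖) := by gcongr
    _ = ((1 + ‖s‖) ^ k * ‖f s‖) * ((1 + ‖s + z.1‖) ^ k * ‖g (s + z.1)‖) := by ring
    _ ≤ (S * weight s) * S' :=
        mul_le_mul (hS s) (hS' _) (by positivity) (mul_nonneg hS0 (weight_pos s).le)
    _ = _ := by ring

/-- Decay in the translation variable is direct. Decay in the frequency variable is the same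
estimate for the Fourier transforms, because R moves the frequency into the translation slot. -/
theorem rightCoeff_decay (f g : 𝓢(ℝ, ℂ)) (k : ℕ) :
    ∃ C, 0 ≤ C ∧ ∀ z, (1 + ‖z‖) ^ k * ‖rightCoeff f g z‖ ≤ C := by
  obtain ⟨C, hC0, hC⟩ := rightCoeff_decay_fst f g k
  obtain ⟨C', hC0', hC'⟩ := rightCoeff_decay_fst (𝓕 f) (𝓕 g) k
  refine ⟨C + C', by positivity, fun z => ?_⟩
  have h2 := hC' (rot z)
  rw [rightCoeff_fourier, norm_mul, norm_beta, one_mul, rot, abs_neg] at h2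
  rw [Prod.norm_def]
  rcases max_choice ‖z.1‖ ‖z.2‖ with h | h <;> rw [h]
  · exact (hC z).trans (by linarith)
  · exact h2.trans (by linarith)

theorem continuous_rightCoeff (f g : 𝓢(ℝ, ℂ)) : Continuous (rightCoeff f g) := by
  obtain ⟨S, hS0, hS⟩ := exists_le_weight f 0
  obtain ⟨S', hS0', hS'⟩ := exists_one_add_pow_mul_le g 0
  simp only [pow_zero, one_mul] at hS hS'
  have hce := continuous_ee
  have hcf := f.continuous
  have hcg := g.continuous
  have hcc : Continuous (starRingEnd ℂ) := Complex.continuous_conj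
  refine continuous_of_dominated (bound := fun s => S * weight s * S') (fun z => ?_) (fun z => ?_)
      ((integrable_weight.const_mul S).mul_const S') (.of_forall fun s => ?_)
  · exact Continuous.aestronglyMeasurable (by fun_prop)
  · refine .of_forall fun s => ?_
    rw [norm_mul, norm_mul, norm_ee, RCLike.norm_conj, mul_one]
    exact mul_le_mul (hS s) (hS' _) (norm_nonneg _) (mul_nonneg hS0 (weight_pos s).le)
  · fun_prop

/-! ### The symplectic Fourier transform of a product of coefficients -/

/-- The Schwartz function `s ↦ conj (f s) g (s + u)`. -/
noncomputable def conjMulShift (f g : 𝓢(ℝ, ℂ)) (u : ℝ) : 𝓢(ℝ, ℂ) :=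
  SchwartzMap.pairing (ContinuousLinearMap.mul ℝ ℂ)
    (f.postcompCLM (𝕜 := ℝ) (Complex.conjCLE : ℂ →L[ℝ] ℂ)) (schwartzShift (u, 0) g)

theorem conjMulShift_apply (f g : 𝓢(ℝ, ℂ)) (u s : ℝ) :
    conjMulShift f g u s = conj (f s) * g (s + u) := by
  rw [conjMulShift, SchwartzMap.pairing_apply_apply, SchwartzMap.postcompCLM_apply,
    schwartzShift_apply]
  simp [ee_zero]

theorem fourier_eq_integral_ee (f : ℝ → ℂ) (ξ : ℝ) : 𝓕 f ξ = ∫ x, ee (-(x * ξ)) * f x := by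
  rw [Real.fourier_real_eq_integral_exp_smul]
  congr 1; funext x
  rw [smul_eq_mul, ee]
  congr 2; push_cast; ring

theorem rightCoeff_eq_fourier (f g : 𝓢(ℝ, ℂ)) (u v : ℝ) :
    rightCoeff f g (u, v) = 𝓕 (conjMulShift f g u) (-v) := by
  rw [SchwartzMap.fourier_coe, fourier_eq_integral_ee, rightCoeff]
  congr 1; funext s
  rw [conjMulShift_apply]
  simp only [mul_neg, neg_neg]; ring

/-- Plancherel in the frequency variable: for fixed u each coefficient is a reflected Fourier
transform of `conjMulShift`, and the extra character becomes a translation by a. -/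
theorem integral_conj_rightCoeff_mul_slice (f g k h : 𝓢(ℝ, ℂ)) (u a : ℝ) :
    ∫ v, conj (rightCoeff f g (u, v)) * rightCoeff k h (u, v) * ee (-(v * a)) =
      ∫ s, (f s * conj (k (s + a))) * (conj (g (s + u)) * h (s + u + a)) := by
  set Q : 𝓢(ℝ, ℂ) := schwartzShift (a, 0) (conjMulShift k h u) with hQ
  have h1 : ∀ v, rightCoeff k h (u, v) * ee (-(v * a)) = 𝓕 Q (-v) := fun v => by
    rw [SchwartzMap.fourier_coe, fourier_eq_integral_ee, rightCoeff_eq_fourier,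
      SchwartzMap.fourier_coe, fourier_eq_integral_ee, ← integral_mul_const]
    conv_lhs => rw [← integral_add_right_eq_self _ a]
    congr 1; funext s
    rw [hQ, schwartzShift_apply, mul_right_comm, ← ee_add]
    simp only [mul_zero, ee_zero, one_mul]
    congr 2; ring
  simp_rw [mul_assoc (conj (rightCoeff f g (u, _))), h1, rightCoeff_eq_fourier f g]
  have h2 := SchwartzMap.integral_inner_fourier_fourier (conjMulShift f g u) Q
  rw [← integral_neg_eq_self] at h2
  simp only [RCLike.inner_apply'] at h2
  refine h2.trans ?_
  congr 1; funext s
  rw [hQ, schwartzShift_apply, conjMulShift_apply, conjMulShift_apply]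
  simp only [mul_zero, ee_zero, one_mul, map_mul, Complex.conj_conj]
  rw [show s + a + u = s + u + a by ring]
  ring

/-- The coordinate map is left general so that the bound serves the coordinates of both D and D^⊥.
The fourth power in the proof spends two powers of decay on each weight. -/
theorem exists_rightCoeff_le_weight (f g : 𝓢(ℝ, ℂ)) (ε : ℝ × ℝ → ℝ × ℝ) (c : ℝ) (hc : 0 ≤ c)
    (hε : ∀ p, ‖p‖ ≤ c * ‖ε p‖) :
    ∃ C, 0 ≤ C ∧ ∀ x y, ‖rightCoeff f g (ε (x, y))‖ ≤ C * (weight x * weight y) := by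
  obtain ⟨C, hC0, hC⟩ := rightCoeff_decay f g 4
  refine ⟨(1 + c) ^ 4 * C, by positivity, fun x y => ?_⟩
  rw [weight, weight, ← mul_inv, ← div_eq_mul_inv, le_div_iff₀ (by positivity)]
  have h0 := hε (x, y)
  have h1 : 1 + ‖(x, y)‖ ≤ (1 + c) * (1 + ‖ε (x, y)‖) := by
    nlinarith [norm_nonneg (ε (x, y)), norm_nonneg (x, y)]
  have hx : 1 + x ^ 2 ≤ (1 + ‖(x, y)‖) ^ 2 := by
    have h := norm_fst_le (x, y)
    rw [Real.norm_eq_abs] at h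
    rw [← sq_abs]; nlinarith [abs_nonneg x]
  have hy : 1 + y ^ 2 ≤ (1 + ‖(x, y)‖) ^ 2 := by
    have h := norm_snd_le (x, y)
    rw [Real.norm_eq_abs] at h
    rw [← sq_abs]; nlinarith [abs_nonneg y]
  calc ‖rightCoeff f g (ε (x, y))‖ * ((1 + x ^ 2) * (1 + y ^ 2))
      ≤ ‖rightCoeff f g (ε (x, y))‖ * ((1 + ‖(x, y)‖) ^ 2 * (1 + ‖(x, y)‖) ^ 2) := by gcongr
    _ = (1 + ‖(x, y)‖) ^ 4 * ‖rightCoeff f g (ε (x, y))‖ := by ring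
    _ ≤ ((1 + c) * (1 + ‖ε (x, y)‖)) ^ 4 * ‖rightCoeff f g (ε (x, y))‖ := by gcongr
    _ = (1 + c) ^ 4 * ((1 + ‖ε (x, y)‖) ^ 4 * ‖rightCoeff f g (ε (x, y))‖) := by ring
    _ ≤ _ := by gcongr; exact hC _

theorem integrable_rightCoeff_mul (f g k h : 𝓢(ℝ, ℂ)) :
    Integrable fun p : ℝ × ℝ => conj (rightCoeff f g p) * rightCoeff k h p := by
  obtain ⟨C, hC0, hC⟩ := exists_rightCoeff_le_weight f g id 1 zero_le_one (by simp)
  obtain ⟨C', hC0', hC'⟩ := exists_rightCoeff_le_weight k h id 1 zero_le_one (by simp)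
  have h1 := continuous_rightCoeff f g
  have h2 := continuous_rightCoeff k h
  have hcc : Continuous (starRingEnd ℂ) := Complex.continuous_conj
  refine ((integrable_weight.mul_prod integrable_weight).const_mul (C * C')).mono'
    (Continuous.aestronglyMeasurable (by fun_prop)) (.of_forall fun p => ?_)
  rw [norm_mul, RCLike.norm_conj]
  have hp1 := weight_pos p.1
  have hp2 := weight_pos p.2
  have h3 : weight p.1 * weight p.2 ≤ 1 :=
    mul_le_one₀ (weight_le_one _) hp2.le (weight_le_one _)
  refine (mul_le_mul (hC p.1 p.2) (hC' p.1 p.2) (norm_nonneg _) (by positivity)).trans ?_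
  calc C * (weight p.1 * weight p.2) * (C' * (weight p.1 * weight p.2))
      = C * C' * (weight p.1 * weight p.2) * (weight p.1 * weight p.2) := by ring
    _ ≤ C * C' * (weight p.1 * weight p.2) * 1 := by gcongr
    _ = _ := by ring

/-- After Plancherel in the frequency, the remaining double integral over (u, s) separates under the
shear u ↦ s + u. The four functions regroup: f with k and g with h, in place of f with g and k with
h. -/
theorem integral_conj_rightCoeff_mul (f g k h : 𝓢(ℝ, ℂ)) (z : ℝ × ℝ) :
    ∫ p : ℝ × ℝ, conj (rightCoeff f g p) * rightCoeff k h p * ee (p.1 * z.2 - p.2 * z.1) =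
      rightCoeff g h z * conj (rightCoeff f k z) := by
  have hce := continuous_ee
  have hint : Integrable fun p : ℝ × ℝ =>
      conj (rightCoeff f g p) * rightCoeff k h p * ee (p.1 * z.2 - p.2 * z.1) := by
    refine (integrable_rightCoeff_mul f g k h).mul_bdd (c := 1)
      (Continuous.aestronglyMeasurable (by fun_prop)) (.of_forall fun p => (norm_ee _).le)
  rw [Measure.volume_eq_prod, integral_prod _ (by rwa [← Measure.volume_eq_prod])]
  have h1 : ∀ u : ℝ, ∫ v : ℝ, conj (rightCoeff f g (u, v)) * rightCoeff k h (u, v) *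
      ee (u * z.2 - v * z.1) = ∫ s, ee (u * z.2) *
        ((f s * conj (k (s + z.1))) * (conj (g (s + u)) * h (s + u + z.1))) := fun u => by
    rw [integral_const_mul, ← integral_conj_rightCoeff_mul_slice, ← integral_const_mul]
    congr 1; funext v
    rw [sub_eq_add_neg, ee_add]; ring
  simp only [h1]
  have hA : Integrable fun s : ℝ => ee (-(s * z.2)) * (f s * conj (k (s + z.1))) := by
    have hi := (conjMulShift f k z.1).integrable (μ := volume)
    refine (hi.norm).mono' ?_ (.of_forall fun s => ?_)
    · have := f.continuous
      have := k.continuous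
      have hcc : Continuous (starRingEnd ℂ) := Complex.continuous_conj
      exact Continuous.aestronglyMeasurable (by fun_prop)
    · simp [conjMulShift_apply, norm_ee]
  have hB : Integrable fun v : ℝ => conj (g v) * h (v + z.1) * ee (v * z.2) := by
    have hi := (conjMulShift g h z.1).integrable (μ := volume)
    refine (hi.norm).mono' ?_ (.of_forall fun s => ?_)
    · have := g.continuous
      have := h.continuous
      have hcc : Continuous (starRingEnd ℂ) := Complex.continuous_conj
      exact Continuous.aestronglyMeasurable (by fun_prop)
    · simp [conjMulShift_apply, norm_ee]
  have hAB : ∀ s u : ℝ, ee (u * z.2) *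
        ((f s * conj (k (s + z.1))) * (conj (g (s + u)) * h (s + u + z.1))) =
      (ee (-(s * z.2)) * (f s * conj (k (s + z.1)))) *
        (conj (g (s + u)) * h (s + u + z.1) * ee ((s + u) * z.2)) := fun s u => by
    have : ee (u * z.2) = ee (-(s * z.2)) * ee ((s + u) * z.2) := by
      rw [← ee_add]; congr 1; ring
    rw [this]; ring
  -- The shear (s, u) ↦ (s, s + u) preserves the measure and pulls this back from a product of two
  -- integrable functions, which allows Fubini.
  have hprod : Integrable (fun p : ℝ × ℝ => (ee (-(p.1 * z.2)) * (f p.1 * conj (k (p.1 + z.1)))) *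
        (conj (g (p.1 + p.2)) * h (p.1 + p.2 + z.1) * ee ((p.1 + p.2) * z.2)))
        ((volume : Measure ℝ).prod volume) :=
    (measurePreserving_prod_add (volume : Measure ℝ) volume).integrable_comp_of_integrable
      (hA.mul_prod hB)
  simp only [hAB]
  rw [← integral_integral_swap (f := fun s u : ℝ =>
    (ee (-(s * z.2)) * (f s * conj (k (s + z.1)))) *
        (conj (g (s + u)) * h (s + u + z.1) * ee ((s + u) * z.2))) hprod]
  simp only [integral_const_mul]
  have h3 : ∀ s : ℝ, ∫ u : ℝ, conj (g (s + u)) * h (s + u + z.1) * ee ((s + u) * z.2) =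
      rightCoeff g h z := fun s =>
    integral_add_left_eq_self (fun v : ℝ => conj (g v) * h (v + z.1) * ee (v * z.2)) s
  simp only [h3]
  rw [integral_mul_const, mul_comm, rightCoeff, rightCoeff, ← integral_conj]
  congr 2; funext s
  rw [map_mul, map_mul, Complex.conj_conj, ee_neg]; ring

/-! ### Square lattices -/

/-- The squared Euclidean length. -/
def sqLength (ε : ℝ × ℝ) : ℝ := ε.1 ^ 2 + ε.2 ^ 2

/-- The lattice spanned by `ε` and `R ε`. -/
def sqLattice (ε : ℝ × ℝ) : Submodule ℤ (ℝ × ℝ) := Submodule.span ℤ {ε, rot ε}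

/-- The linear map `(x, y) ↦ x ε + y R ε`, where `ε` has nonzero length. -/
noncomputable def frameMap (ε : ℝ × ℝ) (hε : sqLength ε ≠ 0) : (ℝ × ℝ) ≃ₗ[ℝ] ℝ × ℝ where
  toFun p := (p.1 * ε.1 - p.2 * ε.2, p.1 * ε.2 + p.2 * ε.1)
  map_add' p q := by ext <;> simp <;> ring
  map_smul' c p := by ext <;> simp <;> ring
  invFun w := ((ε.1 * w.1 + ε.2 * w.2) / sqLength ε, (ε.1 * w.2 - ε.2 * w.1) / sqLength ε)
  left_inv p := by
    ext <;> simp only [div_eq_iff hε] <;> simp only [sqLength] <;> ring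
  right_inv w := by
    ext <;> simp only [sqLength] at hε ⊢ <;> field_simp <;> ring

theorem frameMap_apply (ε : ℝ × ℝ) (hε : sqLength ε ≠ 0) (p : ℝ × ℝ) :
    frameMap ε hε p = (p.1 * ε.1 - p.2 * ε.2, p.1 * ε.2 + p.2 * ε.1) := rfl

theorem det_frameMap (ε : ℝ × ℝ) (hε : sqLength ε ≠ 0) :
    LinearMap.det (frameMap ε hε : (ℝ × ℝ) →ₗ[ℝ] ℝ × ℝ) = sqLength ε := by
  rw [← LinearMap.det_toMatrix (Module.Basis.finTwoProd ℝ), Matrix.det_fin_two]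
  simp [LinearMap.toMatrix_apply, frameMap_apply, sqLength]
  ring

theorem sqLength_nonneg (ε : ℝ × ℝ) : 0 ≤ sqLength ε := by unfold sqLength; positivity

theorem norm_le_mul_norm_frameMap (ε : ℝ × ℝ) (hε : sqLength ε ≠ 0) (p : ℝ × ℝ) :
    ‖p‖ ≤ (|ε.1| + |ε.2|) / sqLength ε * ‖frameMap ε hε p‖ := by
  set w := frameMap ε hε p with hw
  have hp : p = (frameMap ε hε).symm w := by simp [hw]
  have hκ : 0 < sqLength ε := lt_of_le_of_ne (sqLength_nonneg ε) (Ne.symm hε)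
  have h1 := norm_fst_le w
  have h2 := norm_snd_le w
  rw [Real.norm_eq_abs] at h1 h2
  rw [hp, div_mul_eq_mul_div, le_div_iff₀ hκ, Prod.norm_def, max_mul_of_nonneg _ _ hκ.le]
  refine max_le ?_ ?_
  · change ‖(ε.1 * w.1 + ε.2 * w.2) / sqLength ε‖ * _ ≤ _
    rw [norm_div, Real.norm_of_nonneg hκ.le, div_mul_cancel₀ _ hε, Real.norm_eq_abs]
    refine (abs_add_le _ _).trans ?_
    rw [abs_mul, abs_mul]
    nlinarith [abs_nonneg ε.1, abs_nonneg ε.2]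
  · change ‖(ε.1 * w.2 - ε.2 * w.1) / sqLength ε‖ * _ ≤ _
    rw [norm_div, Real.norm_of_nonneg hκ.le, div_mul_cancel₀ _ hε, Real.norm_eq_abs]
    refine (abs_sub _ _).trans ?_
    rw [abs_mul, abs_mul]
    nlinarith [abs_nonneg ε.1, abs_nonneg ε.2]

theorem mem_sqLattice_iff (ε : ℝ × ℝ) (hε : sqLength ε ≠ 0) (w : ℝ × ℝ) :
    w ∈ sqLattice ε ↔ ∃ p : ℤ × ℤ, frameMap ε hε (p.1, p.2) = w := by
  rw [sqLattice, Submodule.mem_span_pair, Prod.exists]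
  refine exists₂_congr fun m n => ?_
  rw [frameMap_apply]
  refine Eq.congr ?_ rfl
  ext <;> simp [rot]; ring

/-- Orthogonality means that the symplectic form takes integral values on D. The swap and the sign
in the coordinates make the pairing of (m, n) with (j, k) equal to -(mj + nk), the exponent in the
Fourier transform. -/
theorem mem_perp_sqLattice_iff (ε : ℝ × ℝ) (hε : sqLength ε ≠ 0) (z : ℝ × ℝ) :
    z ∈ perp (sqLattice ε) ↔
      ∃ p : ℤ × ℤ, frameMap ε hε (p.2 / sqLength ε, -p.1 / sqLength ε) = z := by
  have h0 : z ∈ perp (sqLattice ε) ↔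
      ∀ x ∈ sqLattice ε, ∃ n : ℤ, x.1 * z.2 - z.1 * x.2 = n := by
    simp only [← ee_eq_ee_iff]; rfl
  rw [h0]
  constructor
  · intro h
    obtain ⟨j, hj⟩ := h ε (Submodule.subset_span (by simp))
    obtain ⟨k, hk⟩ := h (rot ε) (Submodule.subset_span (by simp))
    refine ⟨(-j, -k), ?_⟩
    rw [frameMap_apply]
    simp only [rot] at hk
    push_cast
    rw [← hj, ← hk]
    simp only [sqLength] at hε ⊢
    ext <;> field_simp <;> ring
  · rintro ⟨⟨j, k⟩, rfl⟩ x hx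
    obtain ⟨⟨m, n⟩, rfl⟩ := (mem_sqLattice_iff ε hε x).1 hx
    refine ⟨-(m * j + n * k), ?_⟩
    simp only [frameMap_apply]
    push_cast
    simp only [sqLength] at hε ⊢
    field_simp
    ring

/-- Integral coordinates on the lattice spanned by `ε` and `R ε`. -/
noncomputable def sqLatticeEquiv (ε : ℝ × ℝ) (hε : sqLength ε ≠ 0) : ℤ × ℤ ≃ sqLattice ε :=
  Equiv.ofBijective (fun p => ⟨frameMap ε hε (p.1, p.2), (mem_sqLattice_iff ε hε _).2 ⟨p, rfl⟩⟩)
    ⟨fun p q h => by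
      have := (frameMap ε hε).injective (Subtype.ext_iff.1 h)
      simpa [Prod.ext_iff] using this,
    fun ⟨w, hw⟩ => by
      obtain ⟨p, hp⟩ := (mem_sqLattice_iff ε hε w).1 hw
      exact ⟨p, Subtype.ext hp⟩⟩

/-- Integral coordinates on the orthogonal lattice of the lattice spanned by `ε` and `R ε`. -/
noncomputable def perpSqLatticeEquiv (ε : ℝ × ℝ) (hε : sqLength ε ≠ 0) :
    ℤ × ℤ ≃ perp (sqLattice ε) :=
  Equiv.ofBijective (fun p => ⟨frameMap ε hε (p.2 / sqLength ε, -p.1 / sqLength ε),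
      (mem_perp_sqLattice_iff ε hε _).2 ⟨p, rfl⟩⟩)
    ⟨fun p q h => by
      have := (frameMap ε hε).injective (Subtype.ext_iff.1 h)
      simp only [Prod.ext_iff, div_left_inj' hε, neg_inj, Int.cast_inj] at this
      exact Prod.ext this.2 this.1,
    fun ⟨w, hw⟩ => by
      obtain ⟨p, hp⟩ := (mem_perp_sqLattice_iff ε hε w).1 hw
      exact ⟨p, Subtype.ext hp⟩⟩

theorem covolume_sqLattice (ε : ℝ × ℝ) (hε : sqLength ε ≠ 0) :
    ZLattice.covolume (sqLattice ε) = sqLength ε := by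
  set b := (Module.Basis.finTwoProd ℝ).map (frameMap ε hε) with hb
  have hb0 : b 0 = ε := by simp [hb, frameMap_apply]
  have hb1 : b 1 = rot ε := by simp [hb, frameMap_apply, rot]
  have hD : sqLattice ε = Submodule.span ℤ (Set.range b) := by
    rw [sqLattice]; congr 1
    ext x
    simp [Fin.exists_fin_two, hb0, hb1, eq_comm]
  rw [hD, ZLattice.covolume_eq_measure_fundamentalDomain _ volume
    (ZSpan.isAddFundamentalDomain b volume),
    ZSpan.measureReal_fundamentalDomain b volume (Module.Basis.finTwoProd ℝ)]
  have h1 : ZSpan.fundamentalDomain (Module.Basis.finTwoProd ℝ) =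
      Set.Ico (0 : ℝ) 1 ×ˢ Set.Ico (0 : ℝ) 1 := by
    ext p
    simp [ZSpan.mem_fundamentalDomain, Fin.forall_fin_two]
  have h2 : volume.real (Set.Ico (0 : ℝ) 1 ×ˢ Set.Ico (0 : ℝ) 1) = 1 := by
    rw [Measure.volume_eq_prod, measureReal_prod_prod]; simp
  rw [h1, h2, mul_one, Module.Basis.det_apply, Matrix.det_fin_two]
  have h3 : ∀ i j, (Module.Basis.finTwoProd ℝ).toMatrix b i j =
      (Module.Basis.finTwoProd ℝ).repr (b j) i := fun i j => rfl
  rw [h3, h3, h3, h3, hb0, hb1]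
  simp only [rot, Module.Basis.coe_finTwoProd_repr, Matrix.cons_val_zero, Matrix.cons_val_one]
  rw [← abs_of_nonneg (sqLength_nonneg ε), sqLength]
  congr 1; ring

theorem one_add_pow_le_of_norm_le {c : ℝ} (hc : 0 ≤ c) {p w : ℝ × ℝ} (h : ‖p‖ ≤ c * ‖w‖) :
    ((1 + ‖w‖) ^ 4)⁻¹ ≤ (1 + c) ^ 4 * (weight p.1 * weight p.2) := by
  have h1 : 1 + ‖p‖ ≤ (1 + c) * (1 + ‖w‖) := by nlinarith [norm_nonneg w]
  have hx : 1 + p.1 ^ 2 ≤ (1 + ‖p‖) ^ 2 := by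
    have h := norm_fst_le p
    rw [Real.norm_eq_abs] at h
    rw [← sq_abs]; nlinarith [abs_nonneg p.1]
  have hy : 1 + p.2 ^ 2 ≤ (1 + ‖p‖) ^ 2 := by
    have h := norm_snd_le p
    rw [Real.norm_eq_abs] at h
    rw [← sq_abs]; nlinarith [abs_nonneg p.2]
  rw [weight, weight, ← mul_inv, ← div_eq_mul_inv, le_div_iff₀ (by positivity),
    inv_mul_le_iff₀ (by positivity)]
  calc (1 + p.1 ^ 2) * (1 + p.2 ^ 2) ≤ (1 + ‖p‖) ^ 2 * (1 + ‖p‖) ^ 2 := by gcongr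
    _ = (1 + ‖p‖) ^ 4 := by ring
    _ ≤ ((1 + c) * (1 + ‖w‖)) ^ 4 := by gcongr
    _ = _ := by ring

theorem summable_sqLattice (ε : ℝ × ℝ) (hε : sqLength ε ≠ 0) :
    Summable fun w : sqLattice ε => ((1 + ‖(w : ℝ × ℝ)‖) ^ 4)⁻¹ := by
  rw [← (sqLatticeEquiv ε hε).summable_iff]
  have hc : 0 ≤ (|ε.1| + |ε.2|) / sqLength ε := div_nonneg (by positivity) (sqLength_nonneg ε)
  refine .of_nonneg_of_le (fun p => by simp only [Function.comp_apply]; positivity) (fun p => ?_)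
    (summable_weight_mul.mul_left ((1 + (|ε.1| + |ε.2|) / sqLength ε) ^ 4))
  exact one_add_pow_le_of_norm_le (p := (p.1, p.2)) hc (norm_le_mul_norm_frameMap ε hε _)

theorem summable_perp_sqLattice (ε : ℝ × ℝ) (hε : sqLength ε ≠ 0) :
    Summable fun z : perp (sqLattice ε) => ((1 + ‖(z : ℝ × ℝ)‖) ^ 4)⁻¹ := by
  rw [← (perpSqLatticeEquiv ε hε).summable_iff]
  have hc : 0 ≤ |ε.1| + |ε.2| := by positivity
  have hκ := sqLength_nonneg ε
  refine .of_nonneg_of_le (fun p => by simp only [Function.comp_apply]; positivity) (fun p => ?_)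
    (summable_weight_mul.mul_left ((1 + (|ε.1| + |ε.2|)) ^ 4))
  refine one_add_pow_le_of_norm_le (p := (p.1, p.2)) hc ?_
  have h := norm_le_mul_norm_frameMap ε hε (p.2 / sqLength ε, -p.1 / sqLength ε)
  have h2 : ‖((p.2 / sqLength ε, -p.1 / sqLength ε) : ℝ × ℝ)‖ =
      ‖((p.1 : ℝ), (p.2 : ℝ))‖ / sqLength ε := by
    simp only [Prod.norm_def, norm_div, norm_neg, Real.norm_of_nonneg hκ]
    rw [← max_div_div_right hκ, max_comm]
  rw [h2, div_mul_eq_mul_div, div_le_div_iff_of_pos_right (lt_of_le_of_ne hκ (Ne.symm hε))] at h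
  exact h

/-! ### The fundamental identity -/

theorem integral_comp_frameMap (ε : ℝ × ℝ) (hε : sqLength ε ≠ 0) (F : ℝ × ℝ → ℂ) :
    ∫ p : ℝ × ℝ, F (frameMap ε hε p) = (sqLength ε : ℂ)⁻¹ * ∫ w, F w := by
  have hm := Measure.map_linearMap_addHaar_eq_smul_addHaar (volume : Measure (ℝ × ℝ))
    (f := (frameMap ε hε : (ℝ × ℝ) →ₗ[ℝ] ℝ × ℝ)) (by rwa [det_frameMap])
  rw [det_frameMap, abs_of_nonneg (inv_nonneg.2 (sqLength_nonneg ε))] at hm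
  have he : MeasurableEmbedding (frameMap ε hε) :=
    (frameMap ε hε).toContinuousLinearEquiv.toHomeomorph.measurableEmbedding
  have h1 := he.integral_map (μ := volume) F
  rw [← h1]
  change ∫ y, F y ∂(Measure.map (⇑(frameMap ε hε : (ℝ × ℝ) →ₗ[ℝ] ℝ × ℝ)) volume) = _
  rw [hm, integral_smul_measure, ENNReal.toReal_ofReal (inv_nonneg.2 (sqLength_nonneg ε))]
  simp

/-- Poisson summation for a product of two coefficients read in frame coordinates; the regrouping of
the four functions is that of the symplectic Fourier transform. -/
theorem tsum_conj_rightCoeff_mul (f g k h : 𝓢(ℝ, ℂ)) (ε : ℝ × ℝ) (hε : sqLength ε ≠ 0) :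
    (sqLength ε : ℂ) * ∑' w : sqLattice ε, conj (rightCoeff f g w) * rightCoeff k h w =
      ∑' z : perp (sqLattice ε), rightCoeff g h z * conj (rightCoeff f k z) := by
  have hκ := sqLength_nonneg ε
  have hκ' : 0 < sqLength ε := lt_of_le_of_ne hκ (Ne.symm hε)
  set c : ℝ := (|ε.1| + |ε.2|) / sqLength ε with hc
  have hc0 : 0 ≤ c := div_nonneg (by positivity) hκ
  have hce := continuous_ee
  have hcc : Continuous (starRingEnd ℂ) := Complex.continuous_conj
  have hcL : Continuous (frameMap ε hε) := (frameMap ε hε).toContinuousLinearEquiv.continuous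
  have hcr := continuous_rightCoeff
  set dual : ℝ × ℝ → ℝ × ℝ := fun p => frameMap ε hε (p.2 / sqLength ε, -p.1 / sqLength ε)
  have hcd : Continuous dual := by fun_prop
  obtain ⟨C1, h10, h1⟩ := exists_rightCoeff_le_weight f g (frameMap ε hε) c hc0
    (norm_le_mul_norm_frameMap ε hε)
  obtain ⟨C2, h20, h2⟩ := exists_rightCoeff_le_weight k h (frameMap ε hε) c hc0
    (norm_le_mul_norm_frameMap ε hε)
  have hd : ∀ p : ℝ × ℝ, ‖p‖ ≤ (|ε.1| + |ε.2|) * ‖dual p‖ := fun p => by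
    have h := norm_le_mul_norm_frameMap ε hε (p.2 / sqLength ε, -p.1 / sqLength ε)
    have h2 : ‖((p.2 / sqLength ε, -p.1 / sqLength ε) : ℝ × ℝ)‖ = ‖p‖ / sqLength ε := by
      simp only [Prod.norm_def, norm_div, norm_neg, Real.norm_of_nonneg hκ]
      rw [← max_div_div_right hκ, max_comm]
    rwa [h2, div_mul_eq_mul_div, div_le_div_iff_of_pos_right hκ'] at h
  obtain ⟨C3, h30, h3⟩ := exists_rightCoeff_le_weight g h dual _ (by positivity) hd
  obtain ⟨C4, h40, h4⟩ := exists_rightCoeff_le_weight f k dual _ (by positivity) hd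
  have key := tsum_prod_eq_tsum_prod_fourier
    (Ψ := fun p => conj (rightCoeff f g (frameMap ε hε p)) * rightCoeff k h (frameMap ε hε p))
    -- The factor is the inverse Jacobian of the frame map, and becomes the mass |G/D| on the other
    -- side.
    (Ψ' := fun p => (sqLength ε : ℂ)⁻¹ * (rightCoeff g h (dual p) * conj (rightCoeff f k (dual p))))
    (C := C1 * C2 + (sqLength ε)⁻¹ * (C3 * C4)) (by fun_prop) (by fun_prop) (fun x y => ?_)
    (fun x y => ?_) (fun ξ η => ?_)
  · rw [← (sqLatticeEquiv ε hε).tsum_eq, ← (perpSqLatticeEquiv ε hε).tsum_eq]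
    refine (congrArg (fun s => (sqLength ε : ℂ) * s) key).trans ?_
    rw [tsum_mul_left, mul_inv_cancel_left₀ (by exact_mod_cast hε)]
    rfl
  · rw [norm_mul, RCLike.norm_conj]
    have hx := weight_pos x
    have hy := weight_pos y
    calc _ ≤ (C1 * (weight x * weight y)) * (C2 * (weight x * weight y)) :=
          mul_le_mul (h1 x y) (h2 x y) (norm_nonneg _) (by positivity)
      _ = C1 * C2 * (weight x ^ 2 * weight y ^ 2) := by ring
      _ ≤ _ := by
        gcongr
        exact le_add_of_nonneg_right (by positivity)
  · rw [norm_mul, norm_mul, RCLike.norm_conj, norm_inv, Complex.norm_real, Real.norm_of_nonneg hκ]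
    have hx := weight_pos x
    have hy := weight_pos y
    calc _ ≤ (sqLength ε)⁻¹ * ((C3 * (weight x * weight y)) * (C4 * (weight x * weight y))) := by
          gcongr
          · exact h3 x y
          · exact h4 x y
      _ = (sqLength ε)⁻¹ * (C3 * C4) * (weight x ^ 2 * weight y ^ 2) := by ring
      _ ≤ _ := by
        gcongr
        exact le_add_of_nonneg_left (by positivity)
  · rw [← integral_conj_rightCoeff_mul, ← integral_comp_frameMap ε hε]
    have hint : Integrable fun p : ℝ × ℝ => conj (rightCoeff f g (frameMap ε hε p)) *
        rightCoeff k h (frameMap ε hε p) * ee (-(p.1 * ξ) + -(p.2 * η)) := by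
      refine ((integrable_weight.mul_prod integrable_weight).const_mul (C1 * C2)).mono'
        (Continuous.aestronglyMeasurable (by fun_prop)) (.of_forall fun p => ?_)
      rw [norm_mul, norm_mul, RCLike.norm_conj, norm_ee, mul_one]
      have hp1 := weight_pos p.1
      have hp2 := weight_pos p.2
      have h3 : weight p.1 * weight p.2 ≤ 1 :=
        mul_le_one₀ (weight_le_one _) hp2.le (weight_le_one _)
      calc _ ≤ C1 * (weight p.1 * weight p.2) * (C2 * (weight p.1 * weight p.2)) :=
            mul_le_mul (h1 p.1 p.2) (h2 p.1 p.2) (norm_nonneg _) (by positivity)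
        _ = C1 * C2 * (weight p.1 * weight p.2) * (weight p.1 * weight p.2) := by ring
        _ ≤ C1 * C2 * (weight p.1 * weight p.2) * 1 := by gcongr
        _ = _ := by ring
    have hpair : ∀ p : ℝ × ℝ, (frameMap ε hε p).1 * (dual (ξ, η)).2 -
        (frameMap ε hε p).2 * (dual (ξ, η)).1 = -(p.1 * ξ) + -(p.2 * η) := fun p => by
      simp only [dual, frameMap_apply]
      simp only [sqLength] at hε ⊢
      field_simp
      ring
    simp only [hpair]
    rw [Measure.volume_eq_prod, integral_prod_symm _ (by rwa [← Measure.volume_eq_prod]),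
      fourier_eq_integral_ee]
    congr 1; funext y
    rw [fourier_eq_integral_ee, ← integral_const_mul]
    congr 1; funext x
    rw [ee_add]; ring

/-! ### The inverse square root as a power series -/

section InvSqrt

variable {H : Type*} [NormedAddCommGroup H] [InnerProductSpace ℂ H] [CompleteSpace H]

/-- A scalar power series of radius at least one is analytic on the open unit ball of any Banach
algebra, hence smooth along a smooth curve in that ball. -/
theorem contDiff_tsum_smul_pow {A : Type*} [NormedRing A] [NormedAlgebra ℝ A] [CompleteSpace A]
    {c : ℕ → ℝ} (hc : ∀ r : NNReal, r < 1 → Summable fun n => ‖c n‖ * (r : ℝ) ^ n)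
    {e : ℝ → A} (he : ContDiff ℝ (⊤ : ℕ∞) e) (h1 : ∀ s, ‖e s‖ < 1) :
    ContDiff ℝ (⊤ : ℕ∞) fun s => ∑' n, c n • e s ^ n := by
  set p := FormalMultilinearSeries.ofScalars A c with hp
  have hrad : ∀ r : NNReal, r < 1 → (r : ENNReal) ≤ p.radius := fun r hr => by
    refine p.le_radius_of_summable ?_
    refine .of_nonneg_of_le (fun n => by positivity) (fun n => ?_)
      ((hc r hr).mul_left (max 1 ‖(1 : A)‖))
    rw [hp, FormalMultilinearSeries.ofScalars_norm_eq_mul, mul_right_comm, mul_comm]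
    gcongr
    exact ContinuousMultilinearMap.norm_mkPiAlgebraFin_le
  have hpos : 0 < p.radius :=
    lt_of_lt_of_le (by simp) (hrad (1 / 2) (by rw [← NNReal.coe_lt_coe]; norm_num))
  have han := (p.hasFPowerSeriesOnBall hpos).analyticOnNhd
  have hsum : p.sum = fun x => ∑' n, c n • x ^ n :=
    funext fun x => FormalMultilinearSeries.ofScalars_sum_eq c x
  rw [contDiff_iff_contDiffAt]
  intro s
  have hmem : e s ∈ Metric.eball (0 : A) p.radius := by
    obtain ⟨r, hr1, hr2⟩ := exists_between (show ‖e s‖₊ < 1 from h1 s)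
    rw [Metric.mem_eball, edist_zero_right, enorm_eq_nnnorm]
    exact lt_of_lt_of_le (by exact_mod_cast hr1) (hrad r hr2)
  have h2 : ContDiffAt ℝ (⊤ : ℕ∞) p.sum (e s) := (han _ hmem).contDiffAt
  rw [hsum] at h2
  exact h2.comp s he.contDiffAt

/-- The spectrum of a/r lies in (0, 1), so the binomial series for (1 - y)^{-1/2} at y = 1 - x/r
converges uniformly on the spectrum, and functional calculus turns this into norm convergence.
Membership in the algebra, commutation, σ-invariance and smoothness of orbits of a^{-1/2} are all
read off from this series. -/
theorem exists_hasSum_invSqrt {a : H →L[ℂ] H} (ha : 0 ≤ a) (hu : IsUnit a) :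
    ∃ (r : ℝ) (c : ℕ → ℝ), 0 < r ∧ ‖1 - r⁻¹ • a‖ < 1 ∧
      (∀ q : NNReal, q < 1 → Summable fun n => ‖c n‖ * (q : ℝ) ^ n) ∧
      HasSum (fun n => c n • (1 - r⁻¹ • a) ^ n) (invSqrt a) := by
  have hsa : IsSelfAdjoint a := IsSelfAdjoint.of_nonneg ha
  -- The added one keeps r positive and strictly above the spectrum.
  set r : ℝ := ‖a‖ + 1 with hr
  have hr0 : 0 < r := by positivity
  have hspec : ∀ x ∈ spectrum ℝ a, 0 < x ∧ x < r := fun x hx => by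
    have h0 : 0 ≤ x := spectrum_nonneg_of_nonneg ha hx
    have hne : x ≠ 0 := by
      rintro rfl
      exact spectrum.zero_notMem ℝ hu hx
    have hle := norm_apply_le_norm_cfc (fun x : ℝ => x) a hx (by fun_prop) hsa
    rw [cfc_id' ℝ a] at hle
    exact ⟨lt_of_le_of_ne h0 (Ne.symm hne), by
      have := (le_abs_self x).trans hle
      linarith⟩
  set e : H →L[ℂ] H := 1 - r⁻¹ • a with he
  have hecfc : cfc (fun x : ℝ => 1 - r⁻¹ * x) a = e := by
    rw [cfc_sub (fun _ : ℝ => (1 : ℝ)) (fun x => r⁻¹ * x) a (by fun_prop) (by fun_prop),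
      cfc_const_one ℝ a, cfc_const_mul r⁻¹ (fun x : ℝ => x) a (by fun_prop), cfc_id' ℝ a]
  have he1 : ‖e‖ < 1 := by
    rw [← hecfc]
    refine norm_cfc_lt one_pos fun x hx => ?_
    obtain ⟨h1, h2⟩ := hspec x hx
    have h3 : 0 < r⁻¹ * x := by positivity
    have h4 : r⁻¹ * x < 1 := by rw [inv_mul_lt_iff₀ hr0]; linarith
    rw [Real.norm_of_nonneg (by linarith)]; linarith
  have hxe : ∀ x ∈ spectrum ℝ a, ‖1 - r⁻¹ * x‖ ≤ ‖e‖ := fun x hx => by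
    rw [← hecfc]
    exact norm_apply_le_norm_cfc (fun x : ℝ => 1 - r⁻¹ * x) a hx (by fun_prop) hsa
  -- Taylor coefficients of (1 - y)^{-1/2}; the factor `k` below undoes the rescaling by r.
  set b : ℕ → ℝ := fun n => Ring.choose ((1 / 2 : ℝ) + n - 1) n with hb
  have hball := Real.one_div_one_sub_rpow_hasFPowerSeriesOnBall_zero (1 / 2)
  have hbsum : ∀ q : NNReal, q < 1 → Summable fun n => ‖b n‖ * (q : ℝ) ^ n := fun q hq => by
    have := FormalMultilinearSeries.summable_norm_mul_pow _
      (lt_of_lt_of_le (show (q : ENNReal) < 1 by exact_mod_cast hq) hball.r_le)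
    simpa only [FormalMultilinearSeries.ofScalars_norm] using this
  set k : ℝ := r ^ (-(1 / 2) : ℝ) with hk
  have hcsum : ∀ q : NNReal, q < 1 → Summable fun n => ‖k * b n‖ * (q : ℝ) ^ n := fun q hq => by
    simp only [norm_mul, mul_assoc]
    exact (hbsum q hq).mul_left _
  refine ⟨r, fun n => k * b n, hr0, he1, hcsum, ?_⟩
  have hpow : ∀ x ∈ spectrum ℝ a,
      x ^ (-(1 / 2) : ℝ) = ∑' n, (k * b n) * (1 - r⁻¹ * x) ^ n := fun x hx => by
    obtain ⟨h1, h2⟩ := hspec x hx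
    have hy : 1 - r⁻¹ * x ∈ Metric.eball (0 : ℝ) 1 := by
      rw [Metric.mem_eball, edist_zero_right, ← ofReal_norm]
      exact ENNReal.ofReal_lt_one.2 (lt_of_le_of_lt (hxe x hx) he1)
    have hs := (hball.hasSum hy).tsum_eq
    simp only [FormalMultilinearSeries.ofScalars_apply_eq, zero_add, smul_eq_mul,
      sub_sub_cancel] at hs
    simp only [mul_assoc]
    rw [tsum_mul_left, hs, hk, one_div ((r⁻¹ * x) ^ (1 / 2 : ℝ)),
      ← Real.rpow_neg (by positivity), ← Real.mul_rpow hr0.le (by positivity),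
      mul_inv_cancel_left₀ hr0.ne']
  -- Weierstrass test: on the spectrum |1 - x/r| is at most ‖e‖ < 1.
  have hunif := tendstoUniformlyOn_tsum (s := spectrum ℝ a)
    (f := fun n x => (k * b n) * (1 - r⁻¹ * x) ^ n) (hcsum ‖e‖₊ he1) (fun n x hx => by
      rw [norm_mul, norm_pow]
      gcongr
      exact hxe x hx)
  have hunif' : TendstoUniformlyOn
      (fun (t : Finset ℕ) x => ∑ n ∈ t, (k * b n) * (1 - r⁻¹ * x) ^ n)
      (fun x : ℝ => x ^ (-(1 / 2) : ℝ)) Filter.atTop (spectrum ℝ a) :=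
    hunif.congr_right fun x hx => (hpow x hx).symm
  have hlim := tendsto_cfc_fun hunif' (.of_forall fun t => by fun_prop)
  rw [invSqrt, CFC.rpow_eq_cfc_real ha]
  refine Filter.Tendsto.congr (fun t => ?_) hlim
  have h1 := cfc_sum (fun n (x : ℝ) => (k * b n) * (1 - r⁻¹ * x) ^ n) a t
    (fun i _ => by fun_prop)
  rw [show (fun x : ℝ => ∑ n ∈ t, k * b n * (1 - r⁻¹ * x) ^ n) =
    ∑ n ∈ t, fun x : ℝ => k * b n * (1 - r⁻¹ * x) ^ n by ext; simp, h1]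
  refine Finset.sum_congr rfl fun n _ => ?_
  rw [cfc_const_mul (k * b n) (fun x : ℝ => (1 - r⁻¹ * x) ^ n) a (by fun_prop),
    cfc_pow (fun x : ℝ => 1 - r⁻¹ * x) n a (by fun_prop), hecfc]

theorem isSelfAdjoint_invSqrt (a : H →L[ℂ] H) : IsSelfAdjoint (invSqrt a) :=
  IsSelfAdjoint.of_nonneg CFC.rpow_nonneg

theorem invSqrt_mul_mul_invSqrt {a : H →L[ℂ] H} (ha : 0 ≤ a) (hu : IsUnit a) :
    invSqrt a * a * invSqrt a = 1 := by
  have h : invSqrt a * a ^ (1 : ℝ) * invSqrt a = 1 := by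
    rw [invSqrt, ← CFC.rpow_add hu, ← CFC.rpow_add hu]
    norm_num
    exact CFC.rpow_zero a ha
  rwa [CFC.rpow_one a ha] at h

end InvSqrt

/-! ### The algebra of a lattice -/

/-- Products and adjoints of shifts are scalar multiples of shifts, so their linear span is already
a *-algebra. Consequently continuous linear maps on the algebra need only be compared on shifts. -/
theorem mem_closure_span_heis {D : Submodule ℤ (ℝ × ℝ)} {T : L2R →L[ℂ] L2R}
    (hT : T ∈ latticeAlg D) :
    T ∈ closure (Submodule.span ℂ {T | ∃ w ∈ D, T = heis w} : Set (L2R →L[ℂ] L2R)) := by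
  have hS : ∀ T ∈ Submonoid.closure
      ({T | ∃ w ∈ D, T = heis w} ∪ star {T | ∃ w ∈ D, T = heis w}),
      ∃ (c : ℂ) (w : ℝ × ℝ), w ∈ D ∧ T = c • heis w := by
    intro T hT
    induction hT using Submonoid.closure_induction with
    | mem T hT =>
      rcases hT with ⟨w, hw, rfl⟩ | ⟨w, hw, h⟩
      · exact ⟨1, w, hw, (one_smul _ _).symm⟩
      · exact ⟨beta w w, -w, neg_mem hw, by rw [← star_heis, ← h, star_star]⟩
    | one => exact ⟨1, 0, zero_mem _, by rw [heis_zero, one_smul]⟩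
    | mul S T _ _ hS hT =>
      obtain ⟨c, w, hw, rfl⟩ := hS
      obtain ⟨d, v, hv, rfl⟩ := hT
      exact ⟨c * d * beta w v, w + v, add_mem hw hv, by
        rw [smul_mul_smul_comm, heis_mul, smul_smul]⟩
  refine closure_mono (fun T hT => ?_) hT
  have hT' : T ∈ Submodule.span ℂ (Submonoid.closure
      ({T | ∃ w ∈ D, T = heis w} ∪ star {T | ∃ w ∈ D, T = heis w}) : Set (L2R →L[ℂ] L2R)) := by
    rw [← StarAlgebra.adjoin_eq_span]
    exact hT
  refine Submodule.span_le.2 (fun S hS' => ?_) hT'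
  obtain ⟨c, w, hw, rfl⟩ := hS S hS'
  exact Submodule.smul_mem _ _ (Submodule.subset_span ⟨w, hw, rfl⟩)

theorem clm_eq_on_latticeAlg {D : Submodule ℤ (ℝ × ℝ)} {E : Type*} [NormedAddCommGroup E]
    [NormedSpace ℂ E] {Φ Ψ : (L2R →L[ℂ] L2R) →L[ℂ] E} (h : ∀ w ∈ D, Φ (heis w) = Ψ (heis w))
    {T : L2R →L[ℂ] L2R} (hT : T ∈ latticeAlg D) : Φ T = Ψ T := by
  have hE : Set.EqOn Φ Ψ (Submodule.span ℂ {T | ∃ w ∈ D, T = heis w} : Set (L2R →L[ℂ] L2R)) := by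
    intro S hS
    refine LinearMap.eqOn_span' (f := (Φ : (L2R →L[ℂ] L2R) →ₗ[ℂ] E)) (g := Ψ) ?_ hS
    rintro _ ⟨w, hw, rfl⟩
    exact h w hw
  exact hE.closure Φ.continuous Ψ.continuous (mem_closure_span_heis hT)

theorem isClosed_latticeAlg (D : Submodule ℤ (ℝ × ℝ)) :
    IsClosed (latticeAlg D : Set (L2R →L[ℂ] L2R)) :=
  StarSubalgebra.isClosed_topologicalClosure _

theorem hasSum_mem_latticeAlg {D : Submodule ℤ (ℝ × ℝ)} {ι : Type*} {u : ι → L2R →L[ℂ] L2R}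
    {T : L2R →L[ℂ] L2R} (h : HasSum u T) (hu : ∀ i, u i ∈ latticeAlg D) : T ∈ latticeAlg D :=
  (isClosed_latticeAlg D).mem_of_tendsto h (.of_forall fun _ => sum_mem fun i _ => hu i)

theorem tsum_mem_latticeAlg {D : Submodule ℤ (ℝ × ℝ)} {ι : Type*} {u : ι → L2R →L[ℂ] L2R}
    (hu : ∀ i, u i ∈ latticeAlg D) : ∑' i, u i ∈ latticeAlg D := by
  by_cases h : Summable u
  · exact hasSum_mem_latticeAlg h.hasSum hu
  -- A divergent series has the default sum zero, so membership needs no convergence.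
  · rw [tsum_eq_zero_of_not_summable h]; exact zero_mem _

theorem leftInner_mem (D : Submodule ℤ (ℝ × ℝ)) (f g : 𝓢(ℝ, ℂ)) :
    leftInner D f g ∈ latticeAlg D :=
  (latticeAlg D).smul_mem (tsum_mem_latticeAlg fun w =>
    (latticeAlg D).smul_mem (heis_mem w.2) _) _

theorem rightInner_mem (D : Submodule ℤ (ℝ × ℝ)) (f g : 𝓢(ℝ, ℂ)) :
    rightInner D f g ∈ latticeAlg (perp D) :=
  tsum_mem_latticeAlg fun z => (latticeAlg (perp D)).smul_mem (star_mem (heis_mem z.2)) _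

/-! ### A trace on all bounded operators -/

/-- Take the canonical trace of the algebra generated by all shifts of the plane, whose construction
needs no discreteness, and extend it by Hahn–Banach. One functional then restricts to the trace of
every lattice algebra. -/
theorem exists_heis_functional : ∃ τ : (L2R →L[ℂ] L2R) →L[ℂ] ℂ,
    ∀ w, τ (heis w) = if w = 0 then 1 else 0 := by
  let p : Subspace ℂ (L2R →L[ℂ] L2R) := Subalgebra.toSubmodule (latticeAlg ⊤).toSubalgebra
  let τ₀ : StrongDual ℂ p := canonicalTrace ⊤
  obtain ⟨τ, hτ, -⟩ := exists_extension_norm_eq p τ₀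
  exact ⟨τ, fun w => (hτ ⟨heis w, heis_mem Submodule.mem_top⟩).trans
    (canonicalTrace_heis ⊤ w Submodule.mem_top)⟩

theorem canonicalTrace_eq {τ : (L2R →L[ℂ] L2R) →L[ℂ] ℂ}
    (hτ : ∀ w, τ (heis w) = if w = 0 then 1 else 0) {D : Submodule ℤ (ℝ × ℝ)}
    (T : latticeAlg D) : canonicalTrace D T = τ T := by
  have h := canonicalTrace_unique D
    ⟨⟨⟨fun T => τ T, fun S T => by simp⟩, fun c T => by simp⟩,
      τ.continuous.comp continuous_subtype_val⟩ fun w _ => hτ w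
  rw [← h]; rfl

/-! ### Commutation relations and the coefficients τ(T π_z) of an operator -/

theorem heis_mul_comm (x w : ℝ × ℝ) :
    heis x * heis w = ee (x.1 * w.2 - w.1 * x.2) • (heis w * heis x) := by
  rw [heis_mul, heis_mul, smul_smul, add_comm w x, beta, beta, ← ee_add, sub_add_cancel]

theorem heis_conj (x w : ℝ × ℝ) :
    heis x * heis w * star (heis x) = ee (x.1 * w.2 - w.1 * x.2) • heis w := by
  rw [heis_mul_comm, smul_mul_assoc, mul_assoc, heis_mul_star_self, mul_one]

theorem heis_conj_star (x w : ℝ × ℝ) :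
    heis x * star (heis w) * star (heis x) = ee (-(x.1 * w.2 - w.1 * x.2)) • star (heis w) := by
  rw [star_heis, mul_smul_comm, smul_mul_assoc, heis_conj, smul_comm]
  congr 2
  simp; ring

theorem heis_mul_star_comm {D : Submodule ℤ (ℝ × ℝ)} {w z : ℝ × ℝ} (hw : w ∈ D)
    (hz : z ∈ perp D) : heis w * star (heis z) = star (heis z) * heis w := by
  have h : beta w (-z) = beta (-z) w := (neg_mem hz : -z ∈ perp D) w hw
  rw [star_heis, mul_smul_comm, smul_mul_assoc, heis_mul, heis_mul, h, add_comm]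

theorem functional_heis_mul_heis {τ : (L2R →L[ℂ] L2R) →L[ℂ] ℂ}
    (hτ : ∀ w, τ (heis w) = if w = 0 then 1 else 0) (w z : ℝ × ℝ) :
    τ (heis w * heis z) = if w + z = 0 then beta w z else 0 := by
  rw [heis_mul, map_smul, hτ]; split_ifs <;> simp

theorem functional_star_heis_mul_heis {τ : (L2R →L[ℂ] L2R) →L[ℂ] ℂ}
    (hτ : ∀ w, τ (heis w) = if w = 0 then 1 else 0) (w z : ℝ × ℝ) :
    τ (star (heis w) * heis z) = if w = z then 1 else 0 := by
  split_ifs with h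
  · rw [h, heis_star_mul_self, ← heis_zero, hτ, if_pos rfl]
  · rw [star_heis, smul_mul_assoc, map_smul, functional_heis_mul_heis hτ, if_neg, smul_zero]
    rwa [neg_add_eq_zero]

/-- The number τ(T π_z) is the coefficient of π_z^* in T. Conjugation by π_x acts on it by a
character, which holds on shifts and extends by continuity. -/
theorem functional_conj_mul_heis {τ : (L2R →L[ℂ] L2R) →L[ℂ] ℂ}
    (hτ : ∀ w, τ (heis w) = if w = 0 then 1 else 0) {D : Submodule ℤ (ℝ × ℝ)} {T : L2R →L[ℂ] L2R}
    (hT : T ∈ latticeAlg D) (x z : ℝ × ℝ) :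
    τ (heis x * T * star (heis x) * heis z) =
      ee (-(x.1 * z.2 - z.1 * x.2)) * τ (T * heis z) := by
  let m := ContinuousLinearMap.mul ℂ (L2R →L[ℂ] L2R)
  refine clm_eq_on_latticeAlg (D := D)
    (Φ := τ ∘L (m.flip (heis z)) ∘L (m.flip (star (heis x))) ∘L (m (heis x)))
    (Ψ := ee (-(x.1 * z.2 - z.1 * x.2)) • (τ ∘L (m.flip (heis z)))) (fun w _ => ?_) hT
  change τ (heis x * heis w * star (heis x) * heis z) =
    ee (-(x.1 * z.2 - z.1 * x.2)) * τ (heis w * heis z)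
  rw [heis_conj, smul_mul_assoc, map_smul, functional_heis_mul_heis hτ, smul_eq_mul]
  split_ifs with h
  · rw [eq_neg_of_add_eq_zero_left h]
    congr 2; simp; ring
  · simp

/-- The functional `T ↦ c τ (T S)`. -/
noncomputable def mulFunctional (τ : (L2R →L[ℂ] L2R) →L[ℂ] ℂ) (c : ℂ) (S : L2R →L[ℂ] L2R) :
    (L2R →L[ℂ] L2R) →L[ℂ] ℂ :=
  c • (τ ∘L ((ContinuousLinearMap.mul ℂ (L2R →L[ℂ] L2R)).flip S))

theorem mulFunctional_apply (τ : (L2R →L[ℂ] L2R) →L[ℂ] ℂ) (c : ℂ) (S T : L2R →L[ℂ] L2R) :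
    mulFunctional τ c S T = τ (T * S) * c := mul_comm _ _

theorem norm_mulFunctional_heis_le (τ : (L2R →L[ℂ] L2R) →L[ℂ] ℂ) (c : ℂ) (z : ℝ × ℝ)
    (T : L2R →L[ℂ] L2R) : ‖mulFunctional τ c (heis z) T‖ ≤ ‖τ‖ * ‖c‖ * ‖T‖ := by
  rw [mulFunctional_apply, norm_mul, mul_right_comm]
  gcongr
  refine (τ.le_opNorm _).trans ?_
  gcongr
  exact (norm_mul_le _ _).trans (mul_le_of_le_one_right (norm_nonneg _) (norm_heis_le _))

theorem exists_clm_eq_tsum {E ι : Type*} [NormedAddCommGroup E] [NormedSpace ℂ E]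
    (Λ : ι → E →L[ℂ] ℂ) {M : ι → ℝ} (hM : Summable M) (hM0 : ∀ i, 0 ≤ M i)
    (h : ∀ i x, ‖Λ i x‖ ≤ M i * ‖x‖) : ∃ Φ : E →L[ℂ] ℂ, ∀ x, Φ x = ∑' i, Λ i x := by
  have hs : Summable Λ :=
    .of_norm_bounded hM fun i => (Λ i).opNorm_le_bound (hM0 i) (h i)
  exact ⟨∑' i, Λ i, fun x =>
    (ContinuousLinearMap.apply ℂ ℂ x).map_tsum hs⟩

/-- The functional `T ↦ ⟪u, T v⟫`. -/
noncomputable def matrixCoeff (u v : L2R) : (L2R →L[ℂ] L2R) →L[ℂ] ℂ :=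
  (innerSL ℂ u) ∘L (ContinuousLinearMap.apply ℂ L2R v)

theorem matrixCoeff_apply (u v : L2R) (T : L2R →L[ℂ] L2R) :
    matrixCoeff u v T = inner ℂ u (T v) := rfl

/-- The Fourier series of T is recovered weakly, without norm convergence: if the matrix
coefficients of the shifts are summable, both sides are continuous in T and agree on shifts. -/
theorem inner_eq_tsum_functional {τ : (L2R →L[ℂ] L2R) →L[ℂ] ℂ}
    (hτ : ∀ w, τ (heis w) = if w = 0 then 1 else 0) {D : Submodule ℤ (ℝ × ℝ)}
    {T : L2R →L[ℂ] L2R} (hT : T ∈ latticeAlg D) (u v : L2R)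
    (hs : Summable fun z : D => ‖(inner ℂ u (star (heis z) v) : ℂ)‖) :
    inner ℂ u (T v) = ∑' z : D, τ (T * heis z) * inner ℂ u (star (heis z) v) := by
  obtain ⟨Ψ, hΨ⟩ := exists_clm_eq_tsum
    (fun z : D => mulFunctional τ (inner ℂ u (star (heis z) v)) (heis z)) (hs.mul_left ‖τ‖)
    (fun z => by positivity) fun z T => norm_mulFunctional_heis_le τ _ z T
  have hΨ' : ∀ T, Ψ T = ∑' z : D, τ (T * heis z) * inner ℂ u (star (heis z) v) := fun T =>
    (hΨ T).trans (tsum_congr fun z => mulFunctional_apply _ _ _ _)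
  rw [← matrixCoeff_apply, ← hΨ']
  refine clm_eq_on_latticeAlg (fun w hw => ?_) hT
  -- The index is -w because π_w is a multiple of the adjoint of π_{-w}.
  rw [hΨ', tsum_eq_single (⟨-w, neg_mem hw⟩ : D)]
  · rw [matrixCoeff_apply, functional_heis_mul_heis hτ,
      if_pos (add_neg_cancel w), star_heis, neg_neg,
      _root_.smul_apply, inner_smul_right, ← mul_assoc, beta, beta, ← ee_add]
    simp [ee_zero]
  · intro z hz
    rw [functional_heis_mul_heis hτ, if_neg, zero_mul]
    intro h
    exact hz (Subtype.ext (eq_neg_of_add_eq_zero_right h))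

/-! ### Smooth orbits and decay of their coefficients -/

section Orbits

variable {E : Type*} [NormedAddCommGroup E] [NormedSpace ℂ E]

theorem norm_iteratedFDeriv_ee_smul_le (c : ℝ) (x : E) (n : ℕ) (s : ℝ) :
    ‖iteratedFDeriv ℝ n (fun s : ℝ => ee (s * c) • x) s‖ ≤ (2 * Real.pi * |c|) ^ n * ‖x‖ := by
  let L : ℂ →L[ℝ] E := (ContinuousLinearMap.id ℝ ℂ).smulRight x
  have h := L.iteratedFDeriv_comp_left (x := s) (n := ((n : ℕ∞) : WithTop ℕ∞))
    (contDiff_ee_mul c).contDiffAt (i := n) le_rfl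
  change ‖iteratedFDeriv ℝ n (L ∘ fun s : ℝ => ee (s * c)) s‖ ≤ _
  rw [h]
  refine (ContinuousLinearMap.norm_compContinuousMultilinearMap_le _ _).trans ?_
  rw [norm_iteratedFDeriv_ee_mul, mul_comm]
  gcongr
  exact L.opNorm_le_bound (norm_nonneg x) fun b => by simp [L, norm_smul, mul_comm]

theorem contDiff_ee_smul (c : ℝ) (x : E) {n : WithTop ℕ∞} :
    ContDiff ℝ n fun s : ℝ => ee (s * c) • x :=
  (contDiff_ee_mul c).smul contDiff_const

theorem contDiff_tsum_ee_smul [CompleteSpace E] {ι : Type*} (c : ι → ℝ) (x : ι → E)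
    (h : ∀ k : ℕ, Summable fun i => |c i| ^ k * ‖x i‖) :
    ContDiff ℝ (⊤ : ℕ∞) fun s : ℝ => ∑' i, ee (s * c i) • x i := by
  refine contDiff_tsum (v := fun k i => (2 * Real.pi) ^ k * (|c i| ^ k * ‖x i‖))
    (fun i => contDiff_ee_smul _ _) (fun k _ => (h k).mul_left _) fun k i s _ => ?_
  refine (norm_iteratedFDeriv_ee_smul_le _ _ _ _).trans (le_of_eq ?_)
  rw [mul_pow, mul_assoc]

/-- Differentiating the character k times at 0 produces the factor (2π|c|)^k, while Λ commutes with
differentiation. The bound K is separate from Λ so that one estimate holds uniformly over a family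
of functionals. -/
theorem norm_le_of_orbit {B : ℝ → E} (hB : ContDiff ℝ (⊤ : ℕ∞) B) {Λ : E →L[ℂ] ℂ} {K : ℝ}
    (hK : ‖Λ‖ ≤ K) (c : ℝ) (d : ℂ) (h : ∀ s, Λ (B s) = ee (s * c) * d) (k : ℕ) :
    (2 * Real.pi * |c|) ^ k * ‖d‖ ≤ K * ‖iteratedFDeriv ℝ k B 0‖ := by
  have h1 : (Λ.restrictScalars ℝ) ∘ B = fun s => d * ee (s * c) :=
    funext fun s => (h s).trans (mul_comm _ _)
  have h2 := (Λ.restrictScalars ℝ).iteratedFDeriv_comp_left (x := 0) hB.contDiffAt (i := k)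
    (by exact_mod_cast le_top)
  have h3 : ‖iteratedFDeriv ℝ k ((Λ.restrictScalars ℝ) ∘ B) 0‖ = (2 * Real.pi * |c|) ^ k * ‖d‖ := by
    rw [h1, norm_iteratedFDeriv_eq_norm_iteratedDeriv,
      iteratedDeriv_const_mul_field d (fun s : ℝ => ee (s * c)), norm_mul,
      ← norm_iteratedFDeriv_eq_norm_iteratedDeriv, norm_iteratedFDeriv_ee_mul, mul_comm]
  rw [← h3, h2]
  refine (ContinuousLinearMap.norm_compContinuousMultilinearMap_le _ _).trans ?_
  rw [ContinuousLinearMap.norm_restrictScalars]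
  exact mul_le_mul_of_nonneg_right hK (norm_nonneg _)

end Orbits

/-! ### Series of Schwartz functions -/

theorem exists_schwartz_tsum {ι : Type*} (u : ι → 𝓢(ℝ, ℂ)) (M : ℕ → ℕ → ι → ℝ)
    (hM : ∀ k n, Summable (M k n))
    (hu : ∀ k n i t, ‖t‖ ^ k * ‖iteratedFDeriv ℝ n (u i) t‖ ≤ M k n i) :
    ∃ g : 𝓢(ℝ, ℂ), ∀ t, g t = ∑' i, u i t := by
  have hu0 : ∀ n i t, ‖iteratedFDeriv ℝ n (u i) t‖ ≤ M 0 n i := fun n i t => by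
    simpa using hu 0 n i t
  have hsm : ContDiff ℝ (⊤ : ℕ∞) fun t => ∑' i, u i t :=
    contDiff_tsum (fun i => (u i).smooth ⊤) (fun n _ => hM 0 n) fun n i t _ => hu0 n i t
  refine ⟨⟨fun t => ∑' i, u i t, hsm, fun k n => ⟨∑' i, M k n i, fun t => ?_⟩⟩, fun t => rfl⟩
  have h1 := iteratedFDeriv_tsum (𝕜 := ℝ) (N := (⊤ : ℕ∞)) (fun i => (u i).smooth ⊤)
    (v := fun n i => M 0 n i) (fun n _ => hM 0 n) (fun n i t _ => hu0 n i t) (k := n) le_top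
  rw [congrFun h1 t]
  have hs : Summable fun i => ‖iteratedFDeriv ℝ n (u i) t‖ :=
    .of_nonneg_of_le (fun i => norm_nonneg _) (fun i => hu0 n i t) (hM 0 n)
  calc ‖t‖ ^ k * ‖∑' i, iteratedFDeriv ℝ n (u i) t‖
      ≤ ‖t‖ ^ k * ∑' i, ‖iteratedFDeriv ℝ n (u i) t‖ := by
        gcongr; exact norm_tsum_le_tsum_norm hs
    _ = ∑' i, ‖t‖ ^ k * ‖iteratedFDeriv ℝ n (u i) t‖ := tsum_mul_left.symm
    _ ≤ _ := (hs.mul_left _).tsum_le_tsum (fun i => hu k n i t) (hM k n)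

theorem schwartzStarShift_decay (f : 𝓢(ℝ, ℂ)) (k n : ℕ) : ∃ C, 0 ≤ C ∧ ∀ (z : ℝ × ℝ) (t : ℝ),
    ‖t‖ ^ k * ‖iteratedFDeriv ℝ n (schwartzStarShift z f) t‖ ≤ C * (1 + ‖z‖) ^ (k + n) := by
  obtain ⟨C, hC0, hC⟩ := shiftFun_decay f k n
  refine ⟨C, hC0, fun z t => ?_⟩
  have h1 : iteratedFDeriv ℝ n (schwartzStarShift z f) t =
      beta z z • iteratedFDeriv ℝ n (shiftFun (-z) f) t :=
    iteratedFDeriv_const_smul_apply ((contDiff_shiftFun (-z) (f.smooth n)).contDiffAt)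
  rw [h1, norm_smul, norm_beta, one_mul]
  simpa using hC (-z) t

/-- The seminorm of order (k, n) of a shift grows like the power k + n of 1 + ‖z‖. Decay of the
coefficients of order k + n + 4 absorbs this and leaves four powers for summing over the lattice. -/
theorem exists_schwartz_tsum_smul {D : Submodule ℤ (ℝ × ℝ)}
    (hD : Summable fun z : D => ((1 + ‖(z : ℝ × ℝ)‖) ^ 4)⁻¹) {c : ℝ × ℝ → ℂ}
    (hc : ∀ k : ℕ, ∃ C, 0 ≤ C ∧ ∀ z, (1 + ‖z‖) ^ k * ‖c z‖ ≤ C) (f : 𝓢(ℝ, ℂ)) :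
    ∃ g : 𝓢(ℝ, ℂ), ∀ t, g t = ∑' z : D, c z * schwartzStarShift z f t := by
  choose C hC0 hC using hc
  choose S hS0 hS using schwartzStarShift_decay f
  refine exists_schwartz_tsum (fun z : D => c z • schwartzStarShift z f)
    (fun k n z => S k n * C (k + n + 4) * ((1 + ‖(z : ℝ × ℝ)‖) ^ 4)⁻¹)
    (fun k n => hD.mul_left _) fun k n z t => ?_
  have h1 : iteratedFDeriv ℝ n (c z • schwartzStarShift z f : 𝓢(ℝ, ℂ)) t =
      c z • iteratedFDeriv ℝ n (schwartzStarShift z f) t :=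
    iteratedFDeriv_const_smul_apply ((schwartzStarShift (z : ℝ × ℝ) f).smooth n).contDiffAt
  rw [h1, norm_smul, ← div_eq_mul_inv, le_div_iff₀ (by positivity)]
  calc ‖t‖ ^ k * (‖c z‖ * ‖iteratedFDeriv ℝ n (schwartzStarShift z f) t‖) *
        (1 + ‖(z : ℝ × ℝ)‖) ^ 4
      = (‖t‖ ^ k * ‖iteratedFDeriv ℝ n (schwartzStarShift z f) t‖) *
        ((1 + ‖(z : ℝ × ℝ)‖) ^ 4 * ‖c z‖) := by ring
    _ ≤ (S k n * (1 + ‖(z : ℝ × ℝ)‖) ^ (k + n)) * ((1 + ‖(z : ℝ × ℝ)‖) ^ 4 * ‖c z‖) := by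
        exact mul_le_mul_of_nonneg_right (hS k n z t) (by positivity)
    _ = S k n * ((1 + ‖(z : ℝ × ℝ)‖) ^ (k + n + 4) * ‖c z‖) := by ring
    _ ≤ _ := mul_le_mul_of_nonneg_left (hC _ _) (hS0 _ _)

theorem summable_mul_of_decay {D : Submodule ℤ (ℝ × ℝ)}
    (hD : Summable fun z : D => ((1 + ‖(z : ℝ × ℝ)‖) ^ 4)⁻¹) {c : ℝ × ℝ → ℂ}
    (hc : ∀ k : ℕ, ∃ C, 0 ≤ C ∧ ∀ z, (1 + ‖z‖) ^ k * ‖c z‖ ≤ C) (k : ℕ) :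
    Summable fun z : D => ‖(z : ℝ × ℝ)‖ ^ k * ‖c z‖ := by
  obtain ⟨C, hC0, hC⟩ := hc (k + 4)
  refine .of_nonneg_of_le (fun z => by positivity) (fun z => ?_) (hD.mul_left C)
  rw [← div_eq_mul_inv, le_div_iff₀ (by positivity)]
  calc ‖(z : ℝ × ℝ)‖ ^ k * ‖c z‖ * (1 + ‖(z : ℝ × ℝ)‖) ^ 4
      ≤ (1 + ‖(z : ℝ × ℝ)‖) ^ k * ‖c z‖ * (1 + ‖(z : ℝ × ℝ)‖) ^ 4 := by
        gcongr; linarith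
    _ = (1 + ‖(z : ℝ × ℝ)‖) ^ (k + 4) * ‖c z‖ := by ring
    _ ≤ C := hC _

theorem summable_norm_of_decay {D : Submodule ℤ (ℝ × ℝ)}
    (hD : Summable fun z : D => ((1 + ‖(z : ℝ × ℝ)‖) ^ 4)⁻¹) {c : ℝ × ℝ → ℂ}
    (hc : ∀ k : ℕ, ∃ C, 0 ≤ C ∧ ∀ z, (1 + ‖z‖) ^ k * ‖c z‖ ≤ C) :
    Summable fun z : D => ‖c z‖ := by
  simpa using summable_mul_of_decay hD hc 0

/-- Identifies the pointwise sum with the weak sum in L². Sum and integral are exchanged using that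
all shifts of f share one sup bound. -/
theorem inner_tsum_schwartz {D : Submodule ℤ (ℝ × ℝ)} [Countable D] {c : ℝ × ℝ → ℂ}
    (hc : Summable fun z : D => ‖c z‖) (f g k : 𝓢(ℝ, ℂ))
    (hg : ∀ t, g t = ∑' z : D, c z * schwartzStarShift z f t) :
    (inner ℂ (k.toLp 2 volume) (g.toLp 2 volume) : ℂ) =
      ∑' z : D, c z * inner ℂ (k.toLp 2 volume) (star (heis z) (f.toLp 2 volume)) := by
  have hK : ∀ z : ℝ × ℝ, ∀ t, ‖schwartzStarShift z f t‖ = ‖f (t - z.1)‖ := fun z t => by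
    change ‖beta z z * (ee (t * (-z).2) * f (t + (-z).1))‖ = _
    rw [norm_mul, norm_mul, norm_beta, norm_ee]; simp [sub_eq_add_neg]
  obtain ⟨S, hS0, hS⟩ := exists_one_add_pow_mul_le f 0
  simp only [pow_zero, one_mul] at hS
  have hki : Integrable fun t => ‖k t‖ := k.integrable.norm
  have hint : ∀ z : D, Integrable fun t =>
      c z * (conj (k t) * schwartzStarShift z f t) := fun z => by
    refine ((hki.mul_const (‖c z‖ * S))).mono' ?_ (.of_forall fun t => ?_)
    · have h1 := k.continuous
      have h2 := (schwartzStarShift (z : ℝ × ℝ) f).continuous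
      have hcc : Continuous (starRingEnd ℂ) := Complex.continuous_conj
      exact Continuous.aestronglyMeasurable (by fun_prop)
    · rw [norm_mul, norm_mul, RCLike.norm_conj, hK]
      calc ‖c z‖ * (‖k t‖ * ‖f (t - (z : ℝ × ℝ).1)‖) ≤ ‖c z‖ * (‖k t‖ * S) := by
            gcongr; exact hS _
        _ = _ := by ring
  have hsum := hasSum_integral_of_summable_integral_norm hint (by
    refine .of_nonneg_of_le (fun z => by positivity) (fun z => ?_)
      (hc.mul_right ((∫ t, ‖k t‖) * S))
    rw [mul_comm ‖c z‖, mul_assoc, mul_comm S, ← integral_mul_const]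
    refine integral_mono (hint z).norm (hki.mul_const _) fun t => ?_
    rw [norm_mul, norm_mul, RCLike.norm_conj, hK]
    calc ‖c z‖ * (‖k t‖ * ‖f (t - (z : ℝ × ℝ).1)‖) ≤ ‖c z‖ * (‖k t‖ * S) := by
          gcongr; exact hS _
      _ = _ := by ring)
  have h2 : ∀ z : D, ∫ t, c z * (conj (k t) * schwartzStarShift z f t) =
      c z * inner ℂ (k.toLp 2 volume) (star (heis z) (f.toLp 2 volume)) := fun z => by
    rw [integral_const_mul, star_heis_toLp,
      inner_toL2_toL2_eq k (schwartzStarShift z f) volume]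
    simp only [RCLike.inner_apply']
  rw [inner_toL2_toL2_eq k g volume, ← tsum_congr h2, hsum.tsum_eq]
  congr 1; funext t
  rw [RCLike.inner_apply', hg, ← tsum_mul_left]
  exact tsum_congr fun z => by ring

theorem summable_smul_of_norm_le_one {ι E : Type*} [NormedAddCommGroup E] [NormedSpace ℂ E]
    [CompleteSpace E] {c : ι → ℂ} (hc : Summable fun i => ‖c i‖) {x : ι → E}
    (hx : ∀ i, ‖x i‖ ≤ 1) : Summable fun i => c i • x i :=
  .of_norm_bounded hc fun i => by
    rw [norm_smul]; exact mul_le_of_le_one_right (norm_nonneg _) (hx i)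

/-! ### Smooth conjugation orbits and the coefficients of the inverse square root -/

/-- Conjugation passes inside the power series, so the orbit of b is the same series evaluated along
the orbit of 1 - ra. Contractivity of u and v keeps that orbit in the open unit ball. -/
theorem contDiff_conj_tsum_smul_pow {A : Type*} [NormedRing A] [NormedAlgebra ℝ A] [CompleteSpace A]
    {c : ℕ → ℝ} (hc : ∀ r : NNReal, r < 1 → Summable fun n => ‖c n‖ * (r : ℝ) ^ n)
    {a b : A} {r : ℝ} (hb : HasSum (fun n => c n • (1 - r • a) ^ n) b) (h1 : ‖1 - r • a‖ < 1)
    {u v : ℝ → A} (huv : ∀ s, u s * v s = 1) (hvu : ∀ s, v s * u s = 1) (hu : ∀ s, ‖u s‖ ≤ 1)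
    (hv : ∀ s, ‖v s‖ ≤ 1) (ha : ContDiff ℝ (⊤ : ℕ∞) fun s => u s * a * v s) :
    ContDiff ℝ (⊤ : ℕ∞) fun s => u s * b * v s := by
  have he : ∀ s, u s * (1 - r • a) * v s = 1 - r • (u s * a * v s) := fun s => by
    rw [mul_sub, sub_mul, mul_one, huv, mul_smul_comm, smul_mul_assoc]
  have hpow : ∀ s n, u s * (1 - r • a) ^ n * v s = (1 - r • (u s * a * v s)) ^ n := fun s n => by
    rw [← he]
    exact (Units.conj_pow (⟨u s, v s, huv s, hvu s⟩ : Aˣ) (1 - r • a) n).symm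
  have hsum : ∀ s, u s * b * v s = ∑' n, c n • (1 - r • (u s * a * v s)) ^ n := fun s => by
    rw [← ((hb.mul_left (u s)).mul_right (v s)).tsum_eq]
    refine tsum_congr fun n => ?_
    rw [← hpow, mul_smul_comm, smul_mul_assoc]
  rw [show (fun s => u s * b * v s) = fun s => ∑' n, c n • (1 - r • (u s * a * v s)) ^ n from
    funext hsum]
  refine contDiff_tsum_smul_pow hc (contDiff_const.sub (ha.const_smul r)) fun s => ?_
  rw [← he]
  calc ‖u s * (1 - r • a) * v s‖ ≤ ‖u s‖ * ‖1 - r • a‖ * ‖v s‖ :=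
        (norm_mul_le _ _).trans (by gcongr; exact norm_mul_le _ _)
    _ ≤ 1 * ‖1 - r • a‖ * 1 := by gcongr <;> [exact hu s; exact hv s]
    _ < 1 := by rwa [one_mul, mul_one]

theorem rightCoeff_summable {D : Submodule ℤ (ℝ × ℝ)}
    (hD : Summable fun z : D => ((1 + ‖(z : ℝ × ℝ)‖) ^ 4)⁻¹) (f g : 𝓢(ℝ, ℂ)) :
    Summable fun z : D => ‖rightCoeff f g z‖ :=
  summable_norm_of_decay hD (rightCoeff_decay f g)

theorem hasSum_rightInner {D : Submodule ℤ (ℝ × ℝ)}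
    (hD : Summable fun z : perp D => ((1 + ‖(z : ℝ × ℝ)‖) ^ 4)⁻¹) (f g : 𝓢(ℝ, ℂ)) :
    HasSum (fun z : perp D => rightCoeff f g z • star (heis z)) (rightInner D f g) :=
  (summable_smul_of_norm_le_one (rightCoeff_summable hD f g)
    fun z => norm_star_heis_le (z : ℝ × ℝ)).hasSum

/-- Each derivative in s multiplies the z-th term by a factor linear in z, which the rapid decay of
the coefficients absorbs. -/
theorem contDiff_conj_rightInner {D : Submodule ℤ (ℝ × ℝ)}
    (hD : Summable fun z : perp D => ((1 + ‖(z : ℝ × ℝ)‖) ^ 4)⁻¹) (f g : 𝓢(ℝ, ℂ)) (x : ℝ × ℝ) :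
    ContDiff ℝ (⊤ : ℕ∞) fun s : ℝ =>
      heis (s • x) * rightInner D f g * star (heis (s • x)) := by
  have h1 : ∀ s : ℝ, heis (s • x) * rightInner D f g * star (heis (s • x)) =
      ∑' z : perp D, ee (s * -(x.1 * (z : ℝ × ℝ).2 - (z : ℝ × ℝ).1 * x.2)) •
        (rightCoeff f g z • star (heis z)) := fun s => by
    rw [← (((hasSum_rightInner hD f g).mul_left (heis (s • x))).mul_right
      (star (heis (s • x)))).tsum_eq]
    refine tsum_congr fun z => ?_
    rw [mul_smul_comm, smul_mul_assoc, heis_conj_star, smul_comm]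
    congr 2
    simp; ring
  rw [show (fun s : ℝ => heis (s • x) * rightInner D f g * star (heis (s • x))) = _ from funext h1]
  refine contDiff_tsum_ee_smul _ _ fun k => ?_
  refine .of_nonneg_of_le (fun z => by positivity) (fun z => ?_)
    ((summable_mul_of_decay hD (rightCoeff_decay f g) k).mul_left ((2 * ‖x‖) ^ k))
  have h2 : |-(x.1 * (z : ℝ × ℝ).2 - (z : ℝ × ℝ).1 * x.2)| ≤ 2 * ‖x‖ * ‖(z : ℝ × ℝ)‖ := by
    rw [abs_neg]
    refine (abs_sub _ _).trans ?_
    rw [abs_mul, abs_mul]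
    have a1 : |x.1| ≤ ‖x‖ := norm_fst_le x
    have a2 : |x.2| ≤ ‖x‖ := norm_snd_le x
    have b1 : |(z : ℝ × ℝ).1| ≤ ‖(z : ℝ × ℝ)‖ := norm_fst_le (z : ℝ × ℝ)
    have b2 : |(z : ℝ × ℝ).2| ≤ ‖(z : ℝ × ℝ)‖ := norm_snd_le (z : ℝ × ℝ)
    have h3 := mul_le_mul a1 b2 (abs_nonneg _) (norm_nonneg _)
    have h4 := mul_le_mul b1 a2 (abs_nonneg _) (norm_nonneg _)
    linarith
  have h3 : ‖rightCoeff f g z • star (heis z)‖ ≤ ‖rightCoeff f g z‖ := by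
    rw [norm_smul]
    exact mul_le_of_le_one_right (norm_nonneg _) (norm_star_heis_le _)
  calc _ ≤ (2 * ‖x‖ * ‖(z : ℝ × ℝ)‖) ^ k * ‖rightCoeff f g z‖ := by gcongr
    _ = _ := by rw [mul_pow]; ring

/-- Smoothness of the orbit of b under conjugation by π_{sx} bounds the coefficients by powers of
the symplectic pairing of x with z. The directions (1, 0) and (0, 1) control the two coordinates of
z. -/
theorem functional_invSqrt_decay {τ : (L2R →L[ℂ] L2R) →L[ℂ] ℂ}
    (hτ : ∀ w, τ (heis w) = if w = 0 then 1 else 0) {D : Submodule ℤ (ℝ × ℝ)}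
    {a b : L2R →L[ℂ] L2R} {r : ℝ} {c : ℕ → ℝ}
    (hc : ∀ r : NNReal, r < 1 → Summable fun n => ‖c n‖ * (r : ℝ) ^ n)
    (hb : HasSum (fun n => c n • (1 - r • a) ^ n) b) (h1 : ‖1 - r • a‖ < 1)
    (hbD : b ∈ latticeAlg D)
    (ha : ∀ x : ℝ × ℝ, ContDiff ℝ (⊤ : ℕ∞) fun s : ℝ => heis (s • x) * a * star (heis (s • x)))
    (k : ℕ) : ∃ C, 0 ≤ C ∧ ∀ z, (1 + ‖z‖) ^ k * ‖τ (b * heis z)‖ ≤ C := by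
  have hbx : ∀ x : ℝ × ℝ, ∀ k : ℕ, ∃ C, ∀ z : ℝ × ℝ,
      |-(x.1 * z.2 - z.1 * x.2)| ^ k * ‖τ (b * heis z)‖ ≤ C := fun x k => by
    have hB := contDiff_conj_tsum_smul_pow hc hb h1 (u := fun s => heis (s • x))
      (v := fun s => star (heis (s • x))) (fun s => heis_mul_star_self _)
      (fun s => heis_star_mul_self _) (fun s => norm_heis_le _) (fun s => norm_star_heis_le _)
      (ha x)
    refine ⟨‖τ‖ * ‖iteratedFDeriv ℝ k (fun s : ℝ => heis (s • x) * b * star (heis (s • x))) 0‖,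
      fun z => ?_⟩
    have h3 : ‖mulFunctional τ 1 (heis z)‖ ≤ ‖τ‖ :=
      ContinuousLinearMap.opNorm_le_bound _ (by positivity) fun T => by
        simpa using norm_mulFunctional_heis_le τ 1 z T
    refine le_trans ?_ (norm_le_of_orbit hB h3 (-(x.1 * z.2 - z.1 * x.2))
      (τ (b * heis z)) (fun s => by
        rw [mulFunctional_apply, mul_one, functional_conj_mul_heis hτ hbD]
        congr 2
        simp; ring) k)
    gcongr
    -- The factor 2π is at least one and can be dropped.
    exact le_mul_of_one_le_left (abs_nonneg _) (by linarith [Real.pi_gt_three])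
  obtain ⟨C0, h0⟩ := hbx 0 0
  obtain ⟨C1, hC1⟩ := hbx (1, 0) k
  obtain ⟨C2, hC2⟩ := hbx (0, 1) k
  have hnn : ∀ z : ℝ × ℝ, (1 + ‖z‖) ^ k * ‖τ (b * heis z)‖ ≤ 2 ^ k * (C0 + C1 + C2) := fun z => by
    have e0 : ‖τ (b * heis z)‖ ≤ C0 := by simpa using h0 z
    have e1 : |z.2| ^ k * ‖τ (b * heis z)‖ ≤ C1 := by simpa using hC1 z
    have e2 : |z.1| ^ k * ‖τ (b * heis z)‖ ≤ C2 := by simpa using hC2 z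
    have e3 : (1 + ‖z‖) ^ k ≤ 2 ^ k * (1 + |z.2| ^ k + |z.1| ^ k) := by
      have h5 : ‖z‖ ^ k ≤ |z.2| ^ k + |z.1| ^ k := by
        rw [Prod.norm_def]
        rcases max_choice ‖z.1‖ ‖z.2‖ with h | h <;> rw [h, Real.norm_eq_abs] <;>
          simp [abs_nonneg]
      rcases le_total ‖z‖ 1 with h | h
      · calc (1 + ‖z‖) ^ k ≤ 2 ^ k := by gcongr; linarith
          _ ≤ _ := by
            refine le_mul_of_one_le_right (by positivity) ?_
            have : 0 ≤ |z.2| ^ k + |z.1| ^ k := by positivity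
            linarith
      · calc (1 + ‖z‖) ^ k ≤ (2 * ‖z‖) ^ k := by gcongr; linarith
          _ = 2 ^ k * ‖z‖ ^ k := mul_pow _ _ _
          _ ≤ _ := by gcongr; linarith
    calc _ ≤ 2 ^ k * (1 + |z.2| ^ k + |z.1| ^ k) * ‖τ (b * heis z)‖ := by gcongr
      _ = 2 ^ k * (‖τ (b * heis z)‖ + |z.2| ^ k * ‖τ (b * heis z)‖ +
          |z.1| ^ k * ‖τ (b * heis z)‖) := by ring
      _ ≤ _ := by gcongr
  exact ⟨_, le_trans (by positivity) (hnn 0), hnn⟩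

theorem hasSum_smul_pow_mem {D : Submodule ℤ (ℝ × ℝ)} {a b : L2R →L[ℂ] L2R} {r : ℝ} {c : ℕ → ℝ}
    (ha : a ∈ latticeAlg D) (hb : HasSum (fun n => c n • (1 - r • a) ^ n) b) :
    b ∈ latticeAlg D := by
  have hsm : ∀ (t : ℝ) {T : L2R →L[ℂ] L2R}, T ∈ latticeAlg D → t • T ∈ latticeAlg D :=
    fun t T hT => by
      have h : t • T = (t : ℂ) • T := RCLike.real_smul_eq_coe_smul t T
      rw [h]
      exact (latticeAlg D).smul_mem hT _
  exact hasSum_mem_latticeAlg hb fun n =>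
    hsm _ (pow_mem (sub_mem (one_mem _) (hsm _ ha)) n)

/-- The inverse square root of an invertible `⟨f, f⟩` maps Schwartz functions to Schwartz
functions. -/
theorem exists_schwartz_invSqrt {D : Submodule ℤ (ℝ × ℝ)} [Countable (perp D)]
    (hD : Summable fun z : perp D => ((1 + ‖(z : ℝ × ℝ)‖) ^ 4)⁻¹) (f : 𝓢(ℝ, ℂ))
    (hpos : 0 ≤ rightInner D f f) (hu : IsUnit (rightInner D f f)) (h : 𝓢(ℝ, ℂ)) :
    ∃ g : 𝓢(ℝ, ℂ), g.toLp 2 volume = invSqrt (rightInner D f f) (h.toLp 2 volume) := by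
  obtain ⟨τ, hτ⟩ := exists_heis_functional
  obtain ⟨r, c, -, h1, hc, hb⟩ := exists_hasSum_invSqrt hpos hu
  have hbD := hasSum_smul_pow_mem (rightInner_mem D f f) hb
  have hdec := functional_invSqrt_decay hτ hc hb h1 hbD (contDiff_conj_rightInner hD f f)
  obtain ⟨g, hg⟩ := exists_schwartz_tsum_smul hD hdec h
  refine ⟨g, eq_of_inner_schwartz fun k => ?_⟩
  have hcs : Summable fun z : perp D =>
      ‖(inner ℂ (k.toLp 2 volume) (star (heis z) (h.toLp 2 volume)) : ℂ)‖ := by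
    refine (rightCoeff_summable hD h k).congr fun z => ?_
    rw [inner_star_right, rightCoeff_eq_inner, ← inner_conj_symm, RCLike.norm_conj]
  -- Both sides are now the same series, with coefficients τ(b π_z), tested against k.
  rw [inner_eq_tsum_functional hτ hbD _ _ hcs]
  exact inner_tsum_schwartz (summable_norm_of_decay hD hdec) h g k hg

/-! ### The frame operators -/

instance countable_perp_sqLattice (ε : ℝ × ℝ) [h : Fact (sqLength ε ≠ 0)] :
    Countable (perp (sqLattice ε)) :=
  (perpSqLatticeEquiv ε h.out).symm.injective.countable

theorem inner_heis_toLp (f g : 𝓢(ℝ, ℂ)) (w : ℝ × ℝ) :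
    (inner ℂ (f.toLp 2 volume) (heis w (g.toLp 2 volume)) : ℂ) = rightCoeff f g w :=
  (rightCoeff_eq_inner f g w).symm

theorem inner_star_heis_toLp (f g : 𝓢(ℝ, ℂ)) (w : ℝ × ℝ) :
    (inner ℂ (f.toLp 2 volume) (star (heis w) (g.toLp 2 volume)) : ℂ) =
      conj (rightCoeff g f w) := by
  rw [inner_star_right, rightCoeff_eq_inner, inner_conj_symm]

theorem inner_rightInner_apply {D : Submodule ℤ (ℝ × ℝ)}
    (hD : Summable fun z : perp D => ((1 + ‖(z : ℝ × ℝ)‖) ^ 4)⁻¹) (f g h k : 𝓢(ℝ, ℂ)) :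
    (inner ℂ (k.toLp 2 volume) (rightInner D g h (f.toLp 2 volume)) : ℂ) =
      ∑' z : perp D, rightCoeff g h z * conj (rightCoeff f k z) := by
  have h1 := (matrixCoeff (k.toLp 2 volume) (f.toLp 2 volume)).hasSum (hasSum_rightInner hD g h)
  rw [matrixCoeff_apply] at h1
  rw [← h1.tsum_eq]
  refine tsum_congr fun z => ?_
  rw [map_smul, matrixCoeff_apply, inner_star_heis_toLp, smul_eq_mul]

theorem hasSum_leftInner {D : Submodule ℤ (ℝ × ℝ)}
    (hD : Summable fun z : D => ((1 + ‖(z : ℝ × ℝ)‖) ^ 4)⁻¹) (f g : 𝓢(ℝ, ℂ)) :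
    HasSum (fun w : D => (ZLattice.covolume D : ℂ) • (leftCoeff f g w • heis w))
      (leftInner D f g) := by
  refine HasSum.const_smul _ (Summable.hasSum (summable_smul_of_norm_le_one ?_ fun w : D =>
    norm_heis_le (w : ℝ × ℝ)))
  refine (rightCoeff_summable hD f g).congr fun w => ?_
  rw [leftCoeff_eq_conj, RCLike.norm_conj]

theorem inner_leftInner_apply (ε : ℝ × ℝ) (hε : sqLength ε ≠ 0) (f g h k : 𝓢(ℝ, ℂ)) :
    (inner ℂ (k.toLp 2 volume) (leftInner (sqLattice ε) f g (h.toLp 2 volume)) : ℂ) =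
      (sqLength ε : ℂ) * ∑' w : sqLattice ε, conj (rightCoeff f g w) * rightCoeff k h w := by
  have h1 := (matrixCoeff (k.toLp 2 volume) (h.toLp 2 volume)).hasSum
    (hasSum_leftInner (summable_sqLattice ε hε) f g)
  rw [matrixCoeff_apply] at h1
  rw [← h1.tsum_eq, ← tsum_mul_left]
  refine tsum_congr fun z => ?_
  rw [map_smul, map_smul, matrixCoeff_apply, inner_heis_toLp, smul_eq_mul,
    smul_eq_mul, leftCoeff_eq_conj, covolume_sqLattice ε hε]

/-- The associativity relation `⟨f, g⟩_D h = f ⟨g, h⟩_{D^⊥}`. -/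
theorem leftInner_apply_toLp (ε : ℝ × ℝ) (hε : sqLength ε ≠ 0) (f g h : 𝓢(ℝ, ℂ)) :
    leftInner (sqLattice ε) f g (h.toLp 2 volume) =
      rightInner (sqLattice ε) g h (f.toLp 2 volume) :=
  eq_of_inner_schwartz fun k => by
    rw [inner_leftInner_apply ε hε, inner_rightInner_apply (summable_perp_sqLattice ε hε),
      tsum_conj_rightCoeff_mul f g k h ε hε]

/-- Positivity is invisible in the series over D^⊥. Associativity rewrites the quadratic form at h
as κ times the sum of |V(h,f)|² over D, and density of Schwartz functions finishes. -/
theorem rightInner_nonneg (ε : ℝ × ℝ) (hε : sqLength ε ≠ 0) (f : 𝓢(ℝ, ℂ)) :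
    0 ≤ rightInner (sqLattice ε) f f := by
  set a := rightInner (sqLattice ε) f f with ha
  rw [ContinuousLinearMap.nonneg_iff_isPositive, ContinuousLinearMap.isPositive_iff_complex]
  intro v
  refine dense_schwartz.induction_on (p := fun v => ((RCLike.re (inner ℂ (a v) v : ℂ) : ℝ) : ℂ) =
    inner ℂ (a v) v ∧ 0 ≤ RCLike.re (inner ℂ (a v) v : ℂ)) v ?_ fun h => ?_
  · refine IsClosed.and (isClosed_eq ?_ ?_) (isClosed_le continuous_const ?_)
    · exact Complex.continuous_ofReal.comp (RCLike.continuous_re.comp (by fun_prop))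
    · fun_prop
    · exact RCLike.continuous_re.comp (by fun_prop)
  · have h1 : (inner ℂ (a (h.toLp 2 volume)) (h.toLp 2 volume) : ℂ) =
        ((sqLength ε * ∑' w : sqLattice ε, ‖rightCoeff h f w‖ ^ 2 : ℝ) : ℂ) := by
      rw [← inner_conj_symm, ha, ← leftInner_apply_toLp ε hε, inner_leftInner_apply ε hε]
      simp only [Complex.conj_mul']
      norm_cast
      rw [Complex.conj_ofReal]
    rw [h1]
    refine ⟨by simp, ?_⟩
    change 0 ≤ ((_ : ℝ) : ℂ).re
    rw [Complex.ofReal_re]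
    exact mul_nonneg (sqLength_nonneg ε) (tsum_nonneg fun w => by positivity)

theorem commute_rightInner {D : Submodule ℤ (ℝ × ℝ)}
    (hD : Summable fun z : perp D => ((1 + ‖(z : ℝ × ℝ)‖) ^ 4)⁻¹) (f g : 𝓢(ℝ, ℂ)) {w : ℝ × ℝ}
    (hw : w ∈ D) : Commute (heis w) (rightInner D f g) := by
  have h1 := (hasSum_rightInner hD f g).mul_left (heis w)
  have h2 := (hasSum_rightInner hD f g).mul_right (heis w)
  refine h1.unique ?_
  refine h2.congr_fun ?_
  intro z
  rw [mul_smul_comm, smul_mul_assoc, heis_mul_star_comm hw z.2]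

theorem commute_of_hasSum_smul_pow {A : Type*} [NormedRing A] [NormedAlgebra ℝ A] {a b u : A}
    {r : ℝ} {c : ℕ → ℝ} (hb : HasSum (fun n => c n • (1 - r • a) ^ n) b) (h : Commute u a) :
    Commute u b := by
  have hc : ∀ n, Commute u (c n • (1 - r • a) ^ n) := fun n =>
    ((((Commute.one_right u).sub_right (h.smul_right r))).pow_right n).smul_right (c n)
  refine (hb.mul_left u).unique ?_
  rw [show (fun n => u * c n • (1 - r • a) ^ n) = fun n => c n • (1 - r • a) ^ n * u from
    funext fun n => hc n]
  exact hb.mul_right u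

/-! ### The normalized vector -/

/-- If `g = f a^{-1/2}` with `a = ⟨f, f⟩_{D^⊥}` then `⟨g, g⟩_{D^⊥} = 1`. -/
theorem rightInner_normalized_eq_one (ε : ℝ × ℝ) [hε : Fact (sqLength ε ≠ 0)] (f g : 𝓢(ℝ, ℂ))
    (hu : IsUnit (rightInner (sqLattice ε) f f))
    (hg : g.toLp 2 volume = invSqrt (rightInner (sqLattice ε) f f) (f.toLp 2 volume)) :
    rightInner (sqLattice ε) g g = 1 := by
  have hs := summable_perp_sqLattice ε hε.out
  have hpos := rightInner_nonneg ε hε.out f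
  set a := rightInner (sqLattice ε) f f with ha
  obtain ⟨r, c, -, -, -, hb⟩ := exists_hasSum_invSqrt hpos hu
  have hbw : ∀ w ∈ sqLattice ε, Commute (heis w) (invSqrt a) := fun w hw =>
    commute_of_hasSum_smul_pow hb (commute_rightInner hs f f hw)
  have hadj : ∀ u v : L2R, (inner ℂ u (invSqrt a v) : ℂ) = inner ℂ (invSqrt a u) v :=
    fun u v => by
      rw [← inner_star_left, (isSelfAdjoint_invSqrt a).star_eq]
  -- With b = a^{-1/2}: ⟨k, π_w b f⟩ = ⟨bk, π_w f⟩, since b is self-adjoint and commutes with π_w.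
  -- This moves b from g onto the test vector.
  have hR : ∀ k k' : 𝓢(ℝ, ℂ), k'.toLp 2 volume = invSqrt a (k.toLp 2 volume) →
      ∀ w ∈ sqLattice ε, rightCoeff k g w = rightCoeff k' f w := fun k k' hk w hw => by
    rw [rightCoeff_eq_inner, rightCoeff_eq_inner, hg, hk, ← hadj]
    congr 1
    exact congrArg (fun T : L2R →L[ℂ] L2R => T (f.toLp 2 volume)) (hbw w hw)
  refine clm_eq_of_inner_schwartz fun k h => ?_
  -- The test vectors bk and bh are again Schwartz, so the sum over D can be converted back into a
  -- matrix coefficient of a.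
  obtain ⟨k', hk'⟩ := exists_schwartz_invSqrt hs f hpos hu k
  obtain ⟨h', hh'⟩ := exists_schwartz_invSqrt hs f hpos hu h
  rw [← leftInner_apply_toLp ε hε.out, inner_leftInner_apply ε hε.out]
  have h1 : ∑' w : sqLattice ε, conj (rightCoeff h g w) * rightCoeff k g w =
      ∑' w : sqLattice ε, conj (rightCoeff h' f w) * rightCoeff k' f w :=
    tsum_congr fun w => by rw [hR k k' hk' w w.2, hR h h' hh' w w.2]
  rw [h1, ← inner_leftInner_apply ε hε.out, leftInner_apply_toLp ε hε.out, ← ha, hk', hh', ← hadj]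
  congr 1
  exact congrArg (fun T : L2R →L[ℂ] L2R => T (h.toLp 2 volume)) (invSqrt_mul_mul_invSqrt hpos hu)

/-- Applying T ↦ τ(T π_z) to ⟨g,g⟩_{D^⊥} = 1 isolates one coefficient. In particular ‖g‖ = 1. -/
theorem rightCoeff_of_rightInner_eq_one {D : Submodule ℤ (ℝ × ℝ)}
    (hD : Summable fun z : perp D => ((1 + ‖(z : ℝ × ℝ)‖) ^ 4)⁻¹) {g : 𝓢(ℝ, ℂ)}
    (hg : rightInner D g g = 1) {z : ℝ × ℝ} (hz : z ∈ perp D) :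
    rightCoeff g g z = if z = 0 then 1 else 0 := by
  obtain ⟨τ, hτ⟩ := exists_heis_functional
  have h1 := (mulFunctional τ 1 (heis z)).hasSum (hasSum_rightInner hD g g)
  rw [hg, mulFunctional_apply, one_mul, mul_one, hτ] at h1
  rw [← h1.tsum_eq, tsum_eq_single (⟨z, hz⟩ : perp D)]
  · rw [map_smul, mulFunctional_apply, functional_star_heis_mul_heis hτ]
    simp
  · intro z' hz'
    rw [map_smul, mulFunctional_apply, functional_star_heis_mul_heis hτ,
      if_neg fun h => hz' (Subtype.ext h)]
    simp

/-! ### The projection, its trace and the bound on the covolume -/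

theorem isSelfAdjoint_leftInner (ε : ℝ × ℝ) (hε : sqLength ε ≠ 0) (g : 𝓢(ℝ, ℂ)) :
    IsSelfAdjoint (leftInner (sqLattice ε) g g) := by
  refine clm_eq_of_inner_schwartz fun k h => ?_
  have hs := summable_perp_sqLattice ε hε
  rw [inner_star_right, ← inner_conj_symm, leftInner_apply_toLp ε hε, leftInner_apply_toLp ε hε,
    inner_rightInner_apply hs, inner_rightInner_apply hs, Complex.conj_tsum]
  refine tsum_congr fun z => ?_
  rw [map_mul, Complex.conj_conj, mul_comm]

/-- The shifts of g over D^⊥ are orthonormal, so the series ⟨g, π_z^* g⟩_{D^⊥} has the single term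
π_z^*; associativity then evaluates p on π_z^* g. -/
theorem leftInner_apply_star_heis (ε : ℝ × ℝ) (hε : sqLength ε ≠ 0) {g : 𝓢(ℝ, ℂ)}
    (hg : rightInner (sqLattice ε) g g = 1) {z : ℝ × ℝ} (hz : z ∈ perp (sqLattice ε)) :
    leftInner (sqLattice ε) g g (star (heis z) (g.toLp 2 volume)) =
      star (heis z) (g.toLp 2 volume) := by
  have hs := summable_perp_sqLattice ε hε
  have hδ : ∀ z' ∈ perp (sqLattice ε),
      rightCoeff g (schwartzStarShift z g) z' = if z' = z then 1 else 0 := fun z' hz' => by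
    rw [rightCoeff_eq_inner, ← star_heis_toLp, star_heis]
    change (inner ℂ (g.toLp 2 volume) ((heis z' * beta z z • heis (-z)) (g.toLp 2 volume)) : ℂ) = _
    rw [mul_smul_comm, heis_mul, smul_smul, _root_.smul_apply, inner_smul_right,
      ← rightCoeff_eq_inner, rightCoeff_of_rightInner_eq_one hs hg (add_mem hz' (neg_mem hz)),
      ← sub_eq_add_neg]
    simp only [sub_eq_zero]
    split_ifs with h
    · rw [h, beta, beta, ← ee_add]; simp [ee_zero]
    · simp
  have h2 : rightInner (sqLattice ε) g (schwartzStarShift z g) = star (heis z) := by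
    rw [← (hasSum_rightInner hs g (schwartzStarShift z g)).tsum_eq,
      tsum_eq_single (⟨z, hz⟩ : perp (sqLattice ε))]
    · rw [hδ z hz, if_pos rfl, one_smul]
    · intro z' hz'
      rw [hδ z' z'.2, if_neg fun h => hz' (Subtype.ext h), zero_smul]
  conv_lhs => rw [star_heis_toLp, leftInner_apply_toLp ε hε, h2]

theorem hasSum_clm_apply {ι E F : Type*} [NormedAddCommGroup E] [NormedSpace ℂ E]
    [NormedAddCommGroup F] [NormedSpace ℂ F] {T : ι → E →L[ℂ] F} {S : E →L[ℂ] F}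
    (h : HasSum T S) (v : E) : HasSum (fun i => T i v) (S v) :=
  (ContinuousLinearMap.apply ℂ F v).hasSum h

/-- By associativity ph is a series of multiples of π_z^* g, each fixed by p, so p² = p on the dense
set of Schwartz vectors. -/
theorem isStarProjection_leftInner (ε : ℝ × ℝ) (hε : sqLength ε ≠ 0) {g : 𝓢(ℝ, ℂ)}
    (hg : rightInner (sqLattice ε) g g = 1) : IsStarProjection (leftInner (sqLattice ε) g g) := by
  refine ⟨?_, isSelfAdjoint_leftInner ε hε g⟩
  have hs := summable_perp_sqLattice ε hε
  set p := leftInner (sqLattice ε) g g with hp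
  refine clm_eq_of_schwartz fun h => ?_
  have h1 : HasSum (fun z : perp (sqLattice ε) =>
      rightCoeff g h z • star (heis z) (g.toLp 2 volume)) (p (h.toLp 2 volume)) := by
    rw [hp, leftInner_apply_toLp ε hε]
    exact hasSum_clm_apply (hasSum_rightInner hs g h) _
  have h2 := p.hasSum h1
  refine h2.unique ?_
  refine h1.congr_fun fun z => ?_
  rw [map_smul, leftInner_apply_star_heis ε hε hg z.2]

theorem canonicalTrace_leftInner {D : Submodule ℤ (ℝ × ℝ)}
    (hD : Summable fun z : D => ((1 + ‖(z : ℝ × ℝ)‖) ^ 4)⁻¹) {f g : 𝓢(ℝ, ℂ)} :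
    canonicalTrace D ⟨leftInner D f g, leftInner_mem D f g⟩ =
      ZLattice.covolume D * leftCoeff f g 0 := by
  obtain ⟨τ, hτ⟩ := exists_heis_functional
  rw [canonicalTrace_eq hτ]
  have h1 := τ.hasSum (hasSum_leftInner hD f g)
  rw [← h1.tsum_eq, tsum_eq_single (0 : D)]
  · rw [map_smul, map_smul, hτ]
    simp
  · intro w hw
    rw [map_smul, map_smul, hτ,
      if_neg fun h => hw (ZeroMemClass.coe_eq_zero.1 h)]
    simp

/-- The fundamental identity for g alone reads κ ∑_D |V(g,g)|² = 1, and the term at 0 is already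
‖g‖⁴ = 1. This bound removes the ambiguity modulo integers between κ and α. -/
theorem sqLength_le_one (ε : ℝ × ℝ) (hε : sqLength ε ≠ 0) {g : 𝓢(ℝ, ℂ)}
    (hg : rightInner (sqLattice ε) g g = 1) : sqLength ε ≤ 1 := by
  have hδ := fun z (hz : z ∈ perp (sqLattice ε)) =>
    rightCoeff_of_rightInner_eq_one (summable_perp_sqLattice ε hε) hg hz
  have h0 : rightCoeff g g 0 = 1 := by simpa using hδ 0 (zero_mem _)
  have h1 := tsum_conj_rightCoeff_mul g g g g ε hε
  have h2 : ∑' z : perp (sqLattice ε), rightCoeff g g z * conj (rightCoeff g g z) = 1 := by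
    rw [tsum_eq_single (0 : perp (sqLattice ε))]
    · simp [h0]
    · intro z hz
      rw [hδ z z.2, if_neg fun h => hz (ZeroMemClass.coe_eq_zero.1 h), zero_mul]
  rw [h2] at h1
  simp only [Complex.conj_mul'] at h1
  norm_cast at h1
  have hsum : Summable fun w : sqLattice ε => ‖rightCoeff g g w‖ ^ 2 := by
    have hs := rightCoeff_summable (summable_sqLattice ε hε) g g
    obtain ⟨C, hC0, hC⟩ := rightCoeff_decay g g 0
    refine .of_nonneg_of_le (fun w => by positivity) (fun w => ?_) (hs.mul_left C)
    rw [sq]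
    gcongr
    simpa using hC w
  have h3 := hsum.le_tsum (0 : sqLattice ε) fun w _ => by positivity
  rw [ZeroMemClass.coe_zero, h0, norm_one, one_pow] at h3
  calc sqLength ε = sqLength ε * 1 := (mul_one _).symm
    _ ≤ _ := mul_le_mul_of_nonneg_left h3 (sqLength_nonneg ε)
    _ = 1 := h1

/-! ### Covariance under the Fourier transform -/

theorem rot_mem_sqLattice {ε w : ℝ × ℝ} (hw : w ∈ sqLattice ε) : rot w ∈ sqLattice ε := by
  obtain ⟨m, n, rfl⟩ := Submodule.mem_span_pair.1 hw
  refine Submodule.mem_span_pair.2 ⟨-n, m, ?_⟩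
  ext
  · simp [rot]
  · simp [rot]; ring

theorem rot_mem_perp {D : Submodule ℤ (ℝ × ℝ)} (hD : ∀ w ∈ D, rot w ∈ D) {z : ℝ × ℝ}
    (hz : z ∈ perp D) : rot z ∈ perp D := by
  intro x hx
  -- Here -Rx is R⁻¹x; R preserves the symplectic form.
  have h := hz (-rot x) (neg_mem (hD x hx))
  simp only [beta, rot, Prod.fst_neg, Prod.snd_neg, neg_neg] at h ⊢
  rw [mul_comm z.1, neg_mul, ee_neg, mul_comm x.2] at h
  rw [neg_mul, ee_neg, h, Complex.conj_conj]

/-- The rotation `R` as a permutation of an invariant lattice. -/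
def rotEquiv (D : Submodule ℤ (ℝ × ℝ)) (hD : ∀ w ∈ D, rot w ∈ D) : D ≃ D where
  toFun w := ⟨rot w, hD w w.2⟩
  invFun w := ⟨-rot w, neg_mem (hD w w.2)⟩
  left_inv w := by ext <;> simp [rot]
  right_inv w := by ext <;> simp [rot]

theorem continuous_fourierAut : Continuous fourierAut := map_continuous fourierAut

theorem fourierAut_star_heis (z : ℝ × ℝ) :
    fourierAut (star (heis z)) = beta z z • star (heis (rot z)) := by
  rw [map_star, fourierAut_heis, star_smul, RCLike.star_def, Complex.conj_conj]

/-- Lets σ be checked term by term on a series, up to a permutation of the index set by R. -/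
theorem map_eq_of_hasSum_equiv {ι κ M F : Type*} [AddCommMonoid M] [TopologicalSpace M] [T2Space M]
    [FunLike F M M] [AddMonoidHomClass F M M] {u : ι → M} {v : κ → M} {a b : M} (ha : HasSum u a)
    (hb : HasSum v b) (e : ι ≃ κ) (φ : F) (hφ : Continuous φ) (h : ∀ i, φ (u i) = v (e i)) :
    φ a = b := by
  refine (ha.map φ hφ).unique ?_
  rw [show φ ∘ u = v ∘ e from funext h]
  exact e.hasSum_iff.2 hb

/-- The phase that σ puts on the shift is exactly the one relating the coefficients of f, g to those
of their Fourier transforms. -/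
theorem fourierAut_smul_star_heis (f g : 𝓢(ℝ, ℂ)) (z : ℝ × ℝ) :
    fourierAut (rightCoeff f g z • star (heis z)) =
      rightCoeff (𝓕 f) (𝓕 g) (rot z) • star (heis (rot z)) := by
  rw [map_smul, fourierAut_star_heis, rightCoeff_fourier, smul_smul, mul_comm]

theorem fourierAut_smul_heis (c : ℂ) (f g : 𝓢(ℝ, ℂ)) (w : ℝ × ℝ) :
    fourierAut (c • (leftCoeff f g w • heis w)) =
      c • (leftCoeff (𝓕 f) (𝓕 g) (rot w) • heis (rot w)) := by
  rw [map_smul, map_smul, fourierAut_heis, leftCoeff_eq_conj, leftCoeff_eq_conj,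
    rightCoeff_fourier, smul_smul (conj (rightCoeff f g w)), map_mul, mul_comm (conj (beta _ _))]

theorem fourierAut_rightInner {D : Submodule ℤ (ℝ × ℝ)}
    (hs : Summable fun z : perp D => ((1 + ‖(z : ℝ × ℝ)‖) ^ 4)⁻¹) (hD : ∀ w ∈ D, rot w ∈ D)
    (f g : 𝓢(ℝ, ℂ)) : fourierAut (rightInner D f g) = rightInner D (𝓕 f) (𝓕 g) :=
  map_eq_of_hasSum_equiv (hasSum_rightInner hs f g) (hasSum_rightInner hs (𝓕 f) (𝓕 g))
    (rotEquiv (perp D) fun _ => rot_mem_perp hD) fourierAut continuous_fourierAut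
    fun z => fourierAut_smul_star_heis f g z

theorem fourierAut_leftInner {D : Submodule ℤ (ℝ × ℝ)}
    (hs : Summable fun z : D => ((1 + ‖(z : ℝ × ℝ)‖) ^ 4)⁻¹) (hD : ∀ w ∈ D, rot w ∈ D)
    (f g : 𝓢(ℝ, ℂ)) : fourierAut (leftInner D f g) = leftInner D (𝓕 f) (𝓕 g) :=
  map_eq_of_hasSum_equiv (hasSum_leftInner hs f g) (hasSum_leftInner hs (𝓕 f) (𝓕 g))
    (rotEquiv D hD) fourierAut continuous_fourierAut fun w => fourierAut_smul_heis _ f g w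

theorem rightCoeff_smul (c : ℂ) (hc : ‖c‖ = 1) (f g : 𝓢(ℝ, ℂ)) (z : ℝ × ℝ) :
    rightCoeff (c • f) (c • g) z = rightCoeff f g z := by
  unfold rightCoeff
  congr 1
  funext s
  have h : conj c * c = 1 := by rw [Complex.conj_mul', hc]; simp
  simp only [_root_.smul_apply, smul_eq_mul, map_mul]
  linear_combination (conj (f s) * g (s + z.1) * ee (s * z.2)) * h

theorem rightInner_smul (D : Submodule ℤ (ℝ × ℝ)) (c : ℂ) (hc : ‖c‖ = 1) (f g : 𝓢(ℝ, ℂ)) :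
    rightInner D (c • f) (c • g) = rightInner D f g := by
  simp only [rightInner, rightCoeff_smul c hc]

theorem leftInner_smul (D : Submodule ℤ (ℝ × ℝ)) (c : ℂ) (hc : ‖c‖ = 1) (f g : 𝓢(ℝ, ℂ)) :
    leftInner D (c • f) (c • g) = leftInner D f g := by
  simp only [leftInner, leftCoeff_eq_conj, rightCoeff_smul c hc]

theorem map_eq_of_hasSum_smul_pow {A F : Type*} [NormedRing A] [NormedAlgebra ℝ A] [FunLike F A A]
    [RingHomClass F A A] {a b : A} {r : ℝ} {c : ℕ → ℝ}
    (hb : HasSum (fun n => c n • (1 - r • a) ^ n) b) (φ : F) (hφ : Continuous φ) (h : φ a = a) :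
    φ b = b :=
  map_eq_of_hasSum_equiv hb hb (.refl ℕ) φ hφ fun n => by
    rw [Equiv.refl_apply, map_real_smul φ hφ, map_pow, map_sub, map_one, map_real_smul φ hφ, h]

theorem fourierAut_invSqrt {a : L2R →L[ℂ] L2R} (ha : 0 ≤ a) (hu : IsUnit a)
    (h : fourierAut a = a) : fourierAut (invSqrt a) = invSqrt a := by
  obtain ⟨r, c, -, -, -, hb⟩ := exists_hasSum_invSqrt ha hu
  exact map_eq_of_hasSum_smul_pow hb fourierAut continuous_fourierAut h

/-! ### The rotation algebra of a square lattice -/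

/-- The indices of shifts lying in B form a subgroup, because the phases in the product and adjoint
formulas are invertible. -/
theorem heis_mem_of_generators {B : StarSubalgebra ℂ (L2R →L[ℂ] L2R)} {x y : ℝ × ℝ}
    (hx : heis x ∈ B) (hy : heis y ∈ B) {w : ℝ × ℝ} (hw : w ∈ Submodule.span ℤ {x, y}) :
    heis w ∈ B := by
  have hneg : ∀ w, heis w ∈ B → heis (-w) ∈ B := fun w hw => by
    have h1 : heis (-w) = (beta w w)⁻¹ • star (heis w) := by
      rw [star_heis, smul_smul, inv_mul_cancel₀ (beta_ne_zero w w), one_smul]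
    rw [h1]
    exact B.smul_mem (star_mem hw) _
  have hadd : ∀ v w, heis v ∈ B → heis w ∈ B → heis (v + w) ∈ B := fun v w hv hw => by
    have h1 : heis (v + w) = (beta v w)⁻¹ • (heis v * heis w) := by
      rw [heis_mul, smul_smul, inv_mul_cancel₀ (beta_ne_zero v w), one_smul]
    rw [h1]
    exact B.smul_mem (mul_mem hv hw) _
  let S : AddSubgroup (ℝ × ℝ) :=
    { carrier := {w | heis w ∈ B}
      zero_mem' := by
        change heis 0 ∈ B
        rw [heis_zero]; exact one_mem B
      add_mem' := fun {v w} => hadd v w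
      neg_mem' := fun {w} => hneg w }
  have hle : Submodule.span ℤ {x, y} ≤ S.toIntSubmodule := Submodule.span_le.2 (by
    rintro _ (rfl | rfl)
    · exact hx
    · exact hy)
  exact hle hw

theorem latticeAlg_span_pair (x y : ℝ × ℝ) :
    latticeAlg (Submodule.span ℤ {x, y}) =
      (StarAlgebra.adjoin ℂ {heis x, heis y}).topologicalClosure := by
  refine le_antisymm ?_ (StarSubalgebra.topologicalClosure_mono (StarAlgebra.adjoin_mono ?_))
  · refine StarSubalgebra.topologicalClosure_mono (StarAlgebra.adjoin_le ?_)
    rintro _ ⟨w, hw, rfl⟩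
    exact heis_mem_of_generators (StarAlgebra.subset_adjoin ℂ _ (by simp))
      (StarAlgebra.subset_adjoin ℂ _ (by simp)) hw
  · rintro _ (rfl | rfl)
    · exact ⟨x, Submodule.subset_span (by simp), rfl⟩
    · exact ⟨y, Submodule.subset_span (by simp), rfl⟩

theorem map_mem_topologicalClosure_adjoin {A : Type*} [NormedRing A] [StarRing A]
    [NormedStarGroup A] [NormedAlgebra ℂ A] [StarModule ℂ A] {S : Set A} (φ : A ≃⋆ₐ[ℂ] A)
    (hφ : Continuous φ) (h : ∀ x ∈ S, φ x ∈ (StarAlgebra.adjoin ℂ S).topologicalClosure) {T : A}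
    (hT : T ∈ (StarAlgebra.adjoin ℂ S).topologicalClosure) :
    φ T ∈ (StarAlgebra.adjoin ℂ S).topologicalClosure := by
  have hle : (StarAlgebra.adjoin ℂ S).topologicalClosure ≤
      (StarAlgebra.adjoin ℂ S).topologicalClosure.comap (φ : A →⋆ₐ[ℂ] A) :=
    StarSubalgebra.topologicalClosure_minimal (StarAlgebra.adjoin_le h)
      ((StarSubalgebra.isClosed_topologicalClosure _).preimage hφ)
  exact hle hT

theorem fourierAut_symm_heis (w : ℝ × ℝ) :
    fourierAut.symm (heis w) = beta (-rot w) (-rot w) • heis (-rot w) := by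
  refine EquivLike.injective fourierAut ?_
  rw [StarAlgEquiv.apply_symm_apply, map_smul, fourierAut_heis, smul_smul, Complex.mul_conj',
    norm_beta]
  simp [rot]

theorem fourierAut_mem_latticeAlg_iff {D : Submodule ℤ (ℝ × ℝ)} (hD : ∀ w ∈ D, rot w ∈ D)
    (T : L2R →L[ℂ] L2R) : fourierAut T ∈ latticeAlg D ↔ T ∈ latticeAlg D := by
  constructor
  · intro hT
    rw [← fourierAut.symm_apply_apply T]
    refine map_mem_topologicalClosure_adjoin fourierAut.symm (map_continuous fourierAut.symm) ?_ hT
    rintro _ ⟨w, hw, rfl⟩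
    rw [fourierAut_symm_heis]
    exact (latticeAlg D).smul_mem (heis_mem (neg_mem (hD w hw))) _
  · refine map_mem_topologicalClosure_adjoin fourierAut continuous_fourierAut ?_
    rintro _ ⟨w, hw, rfl⟩
    rw [fourierAut_heis]
    exact (latticeAlg D).smul_mem (heis_mem (hD w hw)) _

theorem beta_mul_conj_beta_rot (ε : ℝ × ℝ) :
    beta ε (rot ε) * conj (beta (rot ε) ε) = ee (sqLength ε) := by
  rw [beta, beta, ← ee_neg, ← ee_add]
  simp only [rot, sqLength]
  congr 1; ring

theorem fourierAut_heis_rot_mul {ε : ℝ × ℝ} (h₁ : beta ε ε = 1) (h₂ : beta (rot ε) (rot ε) = 1) :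
    fourierAut (heis (rot ε)) = star (heis ε) := by
  rw [fourierAut_heis, h₂, star_heis, h₁]
  rw [map_one, show rot (rot ε) = -ε from rfl]

/-- A positive number at most one which agrees modulo one with `α ∈ (0, 1)` equals `α`. -/
theorem eq_of_ee_eq {κ α : ℝ} (hα : α ∈ Set.Ioo (0 : ℝ) 1) (h0 : 0 ≤ κ) (h1 : κ ≤ 1)
    (h : ee κ = ee α) : κ = α := by
  obtain ⟨n, hn⟩ := (ee_eq_ee_iff _ _).1 h
  obtain ⟨hα0, hα1⟩ := hα
  have h2 : (-1 : ℝ) < n := by linarith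
  have h3 : (n : ℝ) < 1 := by linarith
  have h4 : n = 0 := by
    have h5 : (-1 : ℤ) < n := by exact_mod_cast h2
    have h6 : n < 1 := by exact_mod_cast h3
    omega
  rw [h4, Int.cast_zero] at hn
  linarith

end RotationAlgebra

/-! ### The main theorem -/

theorem proposition1p1
    (α : ℝ) (hα : α ∈ Set.Ioo (0 : ℝ) 1)
    (ε₁ ε₂ : ℝ × ℝ) (hrot : rot ε₁ = ε₂)
    (h₁ : beta ε₁ ε₁ = 1) (h₂ : beta ε₂ ε₂ = 1)
    (h₁₂ : beta ε₁ ε₂ * (starRingEnd ℂ) (beta ε₂ ε₁) = Complex.exp (2 * Real.pi * Complex.I * α))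
    (D : Submodule ℤ (ℝ × ℝ)) (hD : D = Submodule.span ℤ {ε₁, ε₂}) :
    -- the setting: `C*(D, β)` is generated by `U₁ = π_ε₁` and `U₂ = π_ε₂`, which satisfy the
    -- commutation relation of the rotation algebra, and `σ` is an automorphism of it
    (latticeAlg D = (StarAlgebra.adjoin ℂ {heis ε₁, heis ε₂}).topologicalClosure ∧
      heis ε₁ * heis ε₂ = Complex.exp (2 * Real.pi * Complex.I * α) • (heis ε₂ * heis ε₁) ∧
      (∀ T : L2R →L[ℂ] L2R, fourierAut T ∈ latticeAlg D ↔ T ∈ latticeAlg D) ∧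
      fourierAut (heis ε₁) = heis ε₂ ∧
      fourierAut (heis ε₂) * heis ε₁ = 1 ∧ heis ε₁ * fourierAut (heis ε₂) = 1) ∧
    -- the main claim, with `a = ⟨f, f⟩_{D^⊥}`, `g = f a^{-1/2}` and `p = ⟨g, g⟩_D`
    ∀ lam ∈ ({1, -1, Complex.I, -Complex.I} : Set ℂ), ∀ f : SchwartzMap ℝ ℂ,
      FourierTransform.fourier f = lam • f →
      (∃ b ∈ latticeAlg (perp D), rightInner D f f * b = 1 ∧ b * rightInner D f f = 1) →
      ∃ g : SchwartzMap ℝ ℂ,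
        g.toLp 2 MeasureTheory.volume =
          invSqrt (rightInner D f f) (f.toLp 2 MeasureTheory.volume) ∧
        IsStarProjection (leftInner D g g) ∧
        (∃ hp : leftInner D g g ∈ latticeAlg D,
          canonicalTrace D ⟨leftInner D g g, hp⟩ = (ZLattice.covolume D : ℂ)) ∧
        ZLattice.covolume D = α ∧
        fourierAut (leftInner D g g) = leftInner D g g := by
  subst hrot
  have hee : ee (sqLength ε₁) = ee α := by rw [← beta_mul_conj_beta_rot, h₁₂, ee]
  -- A vanishing length would give e(α) = 1, impossible for 0 < α < 1.
  have hε : sqLength ε₁ ≠ 0 := fun h => by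
    rw [h] at hee
    obtain ⟨n, hn⟩ := (ee_eq_ee_iff _ _).1 hee
    have h3 : (n : ℝ) < 0 := by linarith [hα.1]
    have h4 : (-1 : ℝ) < n := by linarith [hα.2]
    have h5 : n < 0 := by exact_mod_cast h3
    have h6 : (-1 : ℤ) < n := by exact_mod_cast h4
    omega
  have : Fact (sqLength ε₁ ≠ 0) := ⟨hε⟩
  have hR : ∀ w ∈ sqLattice ε₁, rot w ∈ sqLattice ε₁ := fun _ => rot_mem_sqLattice
  refine ⟨⟨?_, ?_, ?_, ?_, ?_, ?_⟩, ?_⟩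
  · rw [hD]; exact latticeAlg_span_pair _ _
  · rw [heis_mul_comm, ← h₁₂, beta_mul_conj_beta_rot]
    congr 2
    simp only [rot, sqLength]; ring
  · intro T
    rw [hD]
    exact fourierAut_mem_latticeAlg_iff hR T
  · rw [fourierAut_heis, h₁, map_one, one_smul]
  · rw [fourierAut_heis_rot_mul h₁ h₂, heis_star_mul_self]
  · rw [fourierAut_heis_rot_mul h₁ h₂, heis_mul_star_self]
  · rintro lam hlam f hf ⟨b, -, hb1, hb2⟩
    have hD' : D = sqLattice ε₁ := hD
    clear hD
    subst hD'
    have hlam1 : ‖lam‖ = 1 := by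
      rcases hlam with rfl | rfl | rfl | rfl <;> simp
    have hs := summable_sqLattice ε₁ hε
    have hsp := summable_perp_sqLattice ε₁ hε
    have hu : IsUnit (rightInner (sqLattice ε₁) f f) := ⟨⟨_, b, hb1, hb2⟩, rfl⟩
    have hpos := rightInner_nonneg ε₁ hε f
    obtain ⟨g, hg⟩ := exists_schwartz_invSqrt hsp f hpos hu f
    have hone := rightInner_normalized_eq_one ε₁ f g hu hg
    have hκ : ZLattice.covolume (sqLattice ε₁) = α := by
      rw [covolume_sqLattice ε₁ hε]
      exact eq_of_ee_eq hα (sqLength_nonneg ε₁) (sqLength_le_one ε₁ hε hone) hee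
    have hσ : fourierAut (rightInner (sqLattice ε₁) f f) = rightInner (sqLattice ε₁) f f := by
      rw [fourierAut_rightInner hsp hR, hf, rightInner_smul _ _ hlam1]
    -- With b = a^{-1/2}: 𝓕(bf) = σ(b)𝓕f = b(λf) = λg.
    have hFg : 𝓕 g = lam • g := by
      refine SchwartzMap.injective_toLp 2 volume ?_
      change (𝓕 g).toLp 2 volume = (lam • g).toLp 2 volume
      rw [← SchwartzMap.toLp_fourier_eq, hg, fourier_clm_apply, fourierAut_invSqrt hpos hu hσ,
        SchwartzMap.toLp_fourier_eq, hf, toLp_smul, toLp_smul, hg, map_smul]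
    refine ⟨g, hg, isStarProjection_leftInner ε₁ hε hone, ⟨leftInner_mem _ g g, ?_⟩, hκ, ?_⟩
    · have h0 := rightCoeff_of_rightInner_eq_one hsp hone (zero_mem _)
      rw [canonicalTrace_leftInner hs, leftCoeff_eq_conj, h0]
      simp
    · rw [fourierAut_leftInner hs hR, hFg, leftInner_smul _ _ hlam1]
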